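/- **Setting.** Let $E$ be a locally compact Polish space and $\mu$ a Borel measure on $E$ that is finite on compact sets. Let $\mathcal N(E)$ be the set of Borel measures on $E$ that are finite on compact sets and have values in $\mathbb N\cup\{\infty\}$, with the $\sigma$-field generated by the maps $\xi\mapsto\xi(A)$, $A\subseteq E$ Borel. A simple point process on $E$ is a random element $X$ of $\mathcal N(E)$ with $X(\{x\})\in\{0,1\}$ for all $x\in E$ almost surely. A bounded positive operator $K$ on the complex space $L^2(E,\mu)$ is *locally trace-class* if for every compact $A\subseteq E$ the compression $K_A=\mathbf 1_A K\mathbf 1_A$ is trace class. Such a $K$ is given on compactly supported functions by a measurable, Hermitian, positive semidefinite, locally square-integrable kernel, $(Kf)(x)=\int K(x,y)f(y)\,d\mu(y)$, normalized on the diagonal so that $\int_A K(x,x)\,d\mu(x)=\operatorname{tr}K_A$ for all compact $A$. We say that $X$ has law $\mathbf P^K$ if $X$ is a simple point process such that, for every $n\ge1$, $(x_1,\dots,x_n)\mapsto\det[K(x_i,x_j)]_{i,j\le n}$ is an $n$-point intensity function of $X$ with respect to $\mu$, i.e. its $\mu^n$-integral over each Borel $S\subseteq E^n$ is the expected number of ordered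 $n$-tuples of distinct points of $X$ that lie in $S$. For a countable discrete set $F$ and an operator $Q$ on $\ell^2(F)=L^2(F,\text{counting measure})$, $\mathbf P^Q$ is defined in the same way, with kernel the matrix of $Q$. **Theorem.** Let $K$ be a locally trace-class positive contraction on $L^2(E,\mu)$, and let $(A_i)_{i\ge1}$ be a partition of $E$ into precompact Borel sets (possibly empty). Then there exist a countable set $F$, a partition $(B_i)_{i\ge1}$ of $F$ (into possibly empty sets) and a positive contraction $Q$ on $\ell^2(F)$ that is unitarily equivalent to $K$, such that the law $\mathbf P^Q$ exists and, whenever $X$ has law $\mathbf P^K$ and $Y$ has law $\mathbf P^Q$, the joint distribution of the counts $(X(A_i))_{i\ge1}$ equals the joint distribution of the counts $(Y(B_i))_{i\ge1}$. -/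

import Mathlib

open MeasureTheory
open scoped ENNReal ComplexOrder

noncomputable section

namespace DPP

/-- `IsPartition A`: the sets `A 0, A 1, …` (some of which may be empty) are pairwise disjoint
and cover the whole space. -/
def IsPartition {E : Type*} (A : ℕ → Set E) : Prop :=
  Pairwise (fun i j => Disjoint (A i) (A j)) ∧ (⋃ i, A i) = Set.univ

/-- A positive contraction on a complex Hilbert space. -/
def IsPositiveContraction {H : Type*} [NormedAddCommGroup H] [InnerProductSpace ℂ H]
    [CompleteSpace H] (T : H →L[ℂ] H) : Prop :=
  T.IsPositive ∧ ‖T‖ ≤ 1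

/-- The sum `∑ i, ⟨b i, T (b i)⟩ ∈ [0, ∞]` over an orthonormal basis `b`. For a positive operator
`T` it does not depend on `b`, and it is the trace of `T`. -/
def traceAlong {H ι : Type*} [NormedAddCommGroup H] [InnerProductSpace ℂ H] [CompleteSpace H]
    (b : HilbertBasis ι ℂ H) (T : H →L[ℂ] H) : ℝ≥0∞ :=
  ∑' i, ENNReal.ofReal (inner ℂ (b i) (T (b i))).re

/-- `T` is positive and of trace class. -/
def IsPositiveTraceClass {H : Type*} [NormedAddCommGroup H] [InnerProductSpace ℂ H]
    [CompleteSpace H] (T : H →L[ℂ] H) : Prop :=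
  T.IsPositive ∧ ∀ (w : Set H) (b : HilbertBasis w ℂ H), traceAlong b T ≠ ∞

section Operators

variable {E : Type*} [MeasurableSpace E]

/-- Multiplication by the indicator function of `A`, the orthogonal projection of `L²(E, μ)` onto
the subspace `L²(A, μ_A)` of functions that vanish outside `A`. -/
def restrictL (μ : Measure E) {A : Set E} (hA : MeasurableSet A) :
    Lp ℂ 2 μ →L[ℂ] Lp ℂ 2 μ :=
  LinearMap.mkContinuous
    { toFun := fun f => ((Lp.memLp f).indicator hA).toLp (A.indicator f)
      map_add' := fun f g => by
        rw [← MemLp.toLp_add]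
        apply MemLp.toLp_congr
        filter_upwards [Lp.coeFn_add f g] with x hx
        by_cases h : x ∈ A
        · simpa [h] using hx
        · simp [h]
      map_smul' := fun c f => by
        rw [RingHom.id_apply, ← MemLp.toLp_const_smul]
        apply MemLp.toLp_congr
        filter_upwards [Lp.coeFn_smul c f] with x hx
        by_cases h : x ∈ A
        · simpa [h] using hx
        · simp [h] }
    1 (fun f => by
      rw [one_mul]
      apply Lp.norm_le_norm_of_ae_le
      filter_upwards [((Lp.memLp f).indicator hA).coeFn_toLp] with x hx
      simp only [LinearMap.coe_mk, AddHom.coe_mk, hx]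
      exact norm_indicator_le_norm_self _ _)

/-- The compression `K_A` of `K` to `A`, as an operator on `L²(E, μ)` that vanishes on the
orthogonal complement of `L²(A, μ_A)`. -/
def compression (μ : Measure E) (K : Lp ℂ 2 μ →L[ℂ] Lp ℂ 2 μ) {A : Set E}
    (hA : MeasurableSet A) : Lp ℂ 2 μ →L[ℂ] Lp ℂ 2 μ :=
  restrictL μ hA ∘L K ∘L restrictL μ hA

/-- `K` is locally trace-class: its compression to every compact set is of trace class.
(A compact set is measurable under the hypotheses used below; the proof of measurability is
quantified here so that the definition needs no further assumption.) -/
def IsLocallyTraceClass [TopologicalSpace E] (μ : Measure E)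
    (K : Lp ℂ 2 μ →L[ℂ] Lp ℂ 2 μ) : Prop :=
  ∀ (A : Set E) (hA : MeasurableSet A), IsCompact A → IsPositiveTraceClass (compression μ K hA)

/-- `k : E² → ℂ` is a kernel of the (positive, locally trace-class) operator `K`.
The operator determines `k` off the diagonal up to `μ²`-null sets; the last field fixes, up to a
`μ`-null set, the values on the diagonal, in the usual way: they are such that the
integral of `k (x, x)` over every compact set is the trace of the compression. -/
structure IsKernel [TopologicalSpace E] (μ : Measure E) (K : Lp ℂ 2 μ →L[ℂ] Lp ℂ 2 μ)
    (k : E → E → ℂ) : Prop where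
  measurable : Measurable (Function.uncurry k)
  /-- The kernel is Hermitian and positive semidefinite. -/
  posSemidef : ∀ (n : ℕ) (x : Fin n → E), (Matrix.of fun i j => k (x i) (x j)).PosSemidef
  /-- The kernel is locally square integrable. -/
  sq_integrable : ∀ A : Set E, IsCompact A →
    IntegrableOn (fun p : E × E => ‖k p.1 p.2‖ ^ 2) (A ×ˢ A) (μ.prod μ)
  /-- `K` is the integral operator with kernel `k`, on compactly supported functions. -/
  apply_eq : ∀ A : Set E, IsCompact A → ∀ f : Lp ℂ 2 μ, (∀ᵐ x ∂μ, x ∉ A → f x = 0) →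
    ∀ᵐ x ∂μ, K f x = ∫ y, k x y * f y ∂μ
  diagonal : ∀ (A : Set E) (hA : MeasurableSet A), IsCompact A →
    ∀ (w : Set (Lp ℂ 2 μ)) (b : HilbertBasis w ℂ (Lp ℂ 2 μ)),
      ∫⁻ x in A, ENNReal.ofReal (k x x).re ∂μ = traceAlong b (compression μ K hA)

end Operators

section PointProcesses

variable (E : Type*) [TopologicalSpace E] [MeasurableSpace E]

/-- The space `𝒩(E)` of measures on `E` that are finite on compact sets and have values in
`ℕ ∪ {∞}`. It carries the σ-field generated by the maps `ξ ↦ ξ A`, for Borel `A`: this is the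
σ-field of Mathlib on `Measure E`, restricted to the subtype. -/
abbrev Config : Type _ :=
  {ξ : Measure E // IsFiniteMeasureOnCompacts ξ ∧
    ∀ A : Set E, MeasurableSet A → ∃ n : ℕ∞, ξ A = (n : ℝ≥0∞)}

variable {E}

/-- `ρ` is an `n`-point intensity function, with respect to `μ`, of the simple point process with
law `P`: for every Borel `S ⊆ Eⁿ`, the expected number of ordered `n`-tuples of distinct points
of the process that lie in `S` is `∫_S ρ dμⁿ`. -/
def IsIntensity (μ : Measure E) (P : Measure (Config E)) (n : ℕ)
    (ρ : (Fin n → E) → ℝ≥0∞) : Prop :=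
  ∀ S : Set (Fin n → E), MeasurableSet S →
    ∫⁻ ξ, Measure.pi (fun _ : Fin n => ξ.1) (S ∩ {x | Function.Injective x}) ∂P
      = ∫⁻ x in S, ρ x ∂(Measure.pi fun _ : Fin n => μ)

/-- `P` is the law of a simple point process that is determinantal with kernel `k` with respect
to the reference measure `μ`. -/
structure IsDeterminantalWith (μ : Measure E) (k : E → E → ℂ) (P : Measure (Config E)) :
    Prop where
  isProbabilityMeasure : IsProbabilityMeasure P
  simple : ∀ᵐ ξ ∂P, ∀ x : E, ξ.1 {x} = 0 ∨ ξ.1 {x} = 1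
  intensity : ∀ n : ℕ, 1 ≤ n → IsIntensity μ P n fun x =>
    ENNReal.ofReal (Matrix.det (Matrix.of fun i j => k (x i) (x j))).re

/-- `P` is the determinantal law `ℙ^K`, for an operator `K` on `L²(E, μ)`. -/
def IsDeterminantalLaw (μ : Measure E) (K : Lp ℂ 2 μ →L[ℂ] Lp ℂ 2 μ)
    (P : Measure (Config E)) : Prop :=
  ∃ k : E → E → ℂ, IsKernel μ K k ∧ IsDeterminantalWith μ k P

/-- The joint law, on `[0, ∞]^ℕ`, of the counts `X(A 0), X(A 1), …` when `X` has law `P`. -/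
def jointCountLaw (P : Measure (Config E)) (A : ℕ → Set E) : Measure (ℕ → ℝ≥0∞) :=
  P.map fun ξ i => ξ.1 (A i)

end PointProcesses

/-- The complex Hilbert space `ℓ²(F)`. -/
abbrev Ell2 (F : Type*) : Type _ := lp (fun _ : F => ℂ) 2

open Classical in
/-- The matrix `Q(x, y) = (Q 𝟙_y)(x)` of an operator `Q` on `ℓ²(F)`. -/
def matrixEntry {F : Type*} (Q : Ell2 F →L[ℂ] Ell2 F) (x y : F) : ℂ :=
  Q (lp.single 2 y (1 : ℂ)) x

/-- `P` is the determinantal law `ℙ^Q`, for an operator `Q` on `ℓ²(F)`, where `F` is a discrete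
space with the counting measure. The kernel is the matrix of `Q`. -/
def IsDiscreteDeterminantalLaw {F : Type*} [TopologicalSpace F] [MeasurableSpace F]
    (Q : Ell2 F →L[ℂ] Ell2 F) (P : Measure (Config F)) : Prop :=
  IsDeterminantalWith Measure.count (matrixEntry Q) P

end DPP

end

/-!
Write `K = R²` with `R` self-adjoint and choose a Hilbert basis `b` of `L²(E, μ)` each of whose
vectors is supported in one of the sets `A i`; let `B i` be the set of the indices of the vectors
supported in `A i`, and `Q` the matrix of `K` in this basis.

Both kernels are Gram kernels, `k (x, y) = ∑ j, v j x * conj (v j y)`, with `v j = R (b j)` on `E`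
and `v' j y = ⟨b y, R (b j)⟩` on `F`. The numbers `∫_{A i} v j * conj (v l)` and
`∫_{B i} v' j * conj (v' l)` agree: both are `⟨R (b l), 𝟙_{A i} R (b j)⟩`. By Cauchy–Binet, the
integral over a product of sets `A i` of the determinant of a truncated Gram kernel is a function
of these numbers, and Hadamard's inequality dominates the determinants, so that all mixed factorial
moments of the two families of counts agree. They are bounded by products of powers of the traces,
so they determine the characteristic functions of the counts.

On a finite set, the probability that the process is a given subset is the determinant of the
matrix with rows from `Q` at the points of the subset and from `1 - Q` at the other points. The law
on a countable set is a limit of these, by compactness of the space of probability measures on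
`{0, 1}^F`.
-/

namespace DPP

open Filter Topology
open scoped Nat ComplexConjugate Matrix

/-! ### Hadamard's inequality -/

section Hadamard

variable {𝕜 n : Type*} [RCLike 𝕜] [Fintype n] [DecidableEq n] {M : Matrix n n 𝕜}

theorem prod_le_one_of_sum_eq_card {ι : Type*} [Fintype ι] {a : ι → ℝ} (ha : ∀ i, 0 ≤ a i)
    (hsum : ∑ i, a i = Fintype.card ι) : ∏ i, a i ≤ 1 :=
  calc ∏ i, a i ≤ ∏ i, Real.exp (a i - 1) :=
        Finset.prod_le_prod (fun i _ => ha i)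
          fun i _ => by linarith [Real.add_one_le_exp (a i - 1)]
    _ = 1 := by simp [← Real.exp_sum, Finset.sum_sub_distrib, hsum]

theorem det_le_one_of_trace_eq_card (hM : M.PosSemidef) (htr : M.trace = Fintype.card n) :
    M.det ≤ 1 := by
  rw [hM.1.trace_eq_sum_eigenvalues] at htr
  have hprod := prod_le_one_of_sum_eq_card hM.eigenvalues_nonneg (by exact_mod_cast htr)
  rw [hM.1.det_eq_prod_eigenvalues]
  exact_mod_cast hprod

theorem det_le_prod_diag_of_diag_pos (hM : M.PosSemidef) (hd : ∀ i, 0 < M i i) :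
    M.det ≤ ∏ i, M i i := by
  let d : n → 𝕜 := fun i => ((√(RCLike.re (M i i)))⁻¹ : ℝ)
  let D : Matrix n n 𝕜 := Matrix.diagonal d
  have hD : Dᴴ = D := by simp [D, d, Matrix.diagonal_conjTranspose, Pi.star_def]
  have hd_mul : ∀ i, d i * M i i * d i = 1 := fun i => by
    obtain ⟨hre, him⟩ := RCLike.pos_iff.1 (hd i)
    have hMi : M i i = (RCLike.re (M i i) : 𝕜) := by simp [RCLike.ext_iff, him]
    rw [hMi, mul_right_comm]
    simp only [d]
    norm_cast
    rw [← mul_inv, Real.mul_self_sqrt hre.le, inv_mul_cancel₀ hre.ne']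
  have hdet : (D * M * D).det * ∏ i, M i i = M.det :=
    calc (D * M * D).det * ∏ i, M i i = (∏ i, d i * M i i * d i) * M.det := by
          simp only [D, Matrix.det_mul, Matrix.det_diagonal, Finset.prod_mul_distrib]
          ring
      _ = M.det := by simp only [hd_mul, Finset.prod_const_one, one_mul]
  have htrace : (D * M * D).trace = Fintype.card n := by
    simp only [Matrix.trace, D, Matrix.diag_apply, Matrix.mul_diagonal, Matrix.diagonal_mul,
      hd_mul, Finset.sum_const, nsmul_one, Finset.card_univ]
  have hle := det_le_one_of_trace_eq_card
    (by simpa only [hD] using hM.conjTranspose_mul_mul_same D) htrace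
  exact hdet ▸ mul_le_of_le_one_left (Finset.prod_nonneg fun i _ => (hd i).le) hle

theorem det_le_prod_diag (hM : M.PosSemidef) : M.det ≤ ∏ i, M i i := by
  by_cases hd : ∃ i, M i i = 0
  · obtain ⟨i, hi⟩ := hd
    have hcol : M *ᵥ Pi.single i 1 = 0 := by
      rw [← hM.dotProduct_mulVec_zero_iff]
      simpa using hi
    rw [Matrix.det_eq_zero_of_column_eq_zero i fun j => by simpa using congrFun hcol j]
    exact Finset.prod_nonneg fun i _ => hM.diag_nonneg
  · push Not at hd
    exact det_le_prod_diag_of_diag_pos hM fun i => hM.diag_nonneg.lt_of_ne' (hd i)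

end Hadamard

/-! ### Mixed determinants -/

section RowPiecewise

variable {R n : Type*} [DecidableEq n]

/-- The matrix whose rows in `S` are those of `M`, the other rows being those of `N`. For a
kernel `Q`, the determinant of `rowPiecewise S Q (1 - Q)` is the probability that the
determinantal process on a finite set is equal to `S`. -/
def rowPiecewise (S : Finset n) (M N : Matrix n n R) : Matrix n n R :=
  Matrix.of fun x y => if x ∈ S then M x y else N x y

variable [CommRing R] [Fintype n]

theorem sum_det_rowPiecewise (M N : Matrix n n R) :
    ∑ S, (rowPiecewise S M N).det = (M + N).det := by
  refine Eq.trans (Finset.sum_congr rfl fun S _ => congrArg Matrix.det ?_)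
    ((Matrix.detRowAlternating (n := n) (R := R)).toMultilinearMap.map_add_univ M N).symm
  ext x y
  by_cases hx : x ∈ S <;> simp [rowPiecewise, Finset.piecewise, hx]

theorem det_rowPiecewise_one (Q : Matrix n n R) (T : Finset n) :
    (rowPiecewise T Q 1).det = (Q.submatrix (Subtype.val : T → n) Subtype.val).det := by
  rw [Matrix.twoBlockTriangular_det _ (· ∈ T) fun i hi j hj => by
    simp [rowPiecewise, hi, (ne_of_mem_of_not_mem hj hi).symm]]
  have hT : (rowPiecewise T Q 1).toSquareBlockProp (· ∈ T)
      = Q.submatrix (Subtype.val : T → n) Subtype.val := by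
    ext x y
    simp [rowPiecewise, Matrix.toSquareBlockProp]
  have hTc : (rowPiecewise T Q 1).toSquareBlockProp (· ∉ T) = 1 := by
    ext x y
    simp [rowPiecewise, Matrix.toSquareBlockProp, x.2, Matrix.one_apply, Subtype.ext_iff]
  rw [hT, hTc, Matrix.det_one, mul_one]
  congr!

theorem sum_det_rowPiecewise_of_subset (Q : Matrix n n R) (T : Finset n) :
    ∑ S with T ⊆ S, (rowPiecewise S Q (1 - Q)).det
      = (Q.submatrix (Subtype.val : T → n) Subtype.val).det := by
  have hadd : Q + rowPiecewise T 0 (1 - Q) = rowPiecewise T Q 1 := by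
    ext x y
    by_cases hx : x ∈ T <;> simp [rowPiecewise, hx]
  rw [← det_rowPiecewise_one, ← hadd, ← sum_det_rowPiecewise, Finset.sum_filter]
  refine Finset.sum_congr rfl fun S _ => ?_
  split_ifs with hS
  · congr 1
    ext x y
    have := @hS x
    by_cases hx : x ∈ S <;> simp_all [rowPiecewise]
  · obtain ⟨x, hxT, hxS⟩ := Finset.not_subset.1 hS
    exact (Matrix.det_eq_zero_of_row_eq_zero x fun y => by simp [rowPiecewise, hxT, hxS]).symm

end RowPiecewise

section Positivity

variable {𝕜 m n : Type*} [RCLike 𝕜] [Fintype m] [DecidableEq m] [Fintype n] [DecidableEq n]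

theorem det_fromBlocks_nonneg_of_posDef {A : Matrix m m 𝕜} {D : Matrix n n 𝕜} (hA : A.PosDef)
    (B : Matrix m n 𝕜) (hD : D.PosSemidef) : 0 ≤ (Matrix.fromBlocks A B (-Bᴴ) D).det := by
  have : Invertible A := hA.isUnit.invertible
  rw [Matrix.det_fromBlocks₁₁]
  refine mul_nonneg hA.det_pos.le (Matrix.PosSemidef.det_nonneg ?_)
  rw [Matrix.neg_mul, Matrix.neg_mul, sub_neg_eq_add, Matrix.invOf_eq_nonsing_inv]
  exact hD.add (hA.inv.posSemidef.conjTranspose_mul_mul_same B)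

theorem det_fromBlocks_nonneg {A : Matrix m m 𝕜} {D : Matrix n n 𝕜} (hA : A.PosSemidef)
    (B : Matrix m n 𝕜) (hD : D.PosSemidef) : 0 ≤ (Matrix.fromBlocks A B (-Bᴴ) D).det := by
  have hcont : Continuous fun ε : ℝ =>
      (Matrix.fromBlocks (A + (ε : 𝕜) • (1 : Matrix m m 𝕜)) B (-Bᴴ) D).det := by
    refine Continuous.matrix_det (Continuous.matrix_fromBlocks ?_ continuous_const
      continuous_const continuous_const)
    fun_prop
  have hlim := (hcont.tendsto 0).mono_left (nhdsWithin_le_nhds (s := Set.Ioi 0))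
  simp only [RCLike.ofReal_zero, zero_smul, add_zero] at hlim
  refine ge_of_tendsto hlim (eventually_nhdsWithin_of_forall fun ε hε => ?_)
  refine det_fromBlocks_nonneg_of_posDef
    (Matrix.PosDef.posSemidef_add hA (Matrix.PosDef.one.smul ?_)) B hD
  exact_mod_cast hε

theorem det_rowPiecewise_one_sub_nonneg {Q : Matrix n n 𝕜} (hQ : Q.PosSemidef)
    (hQ' : (1 - Q).PosSemidef) (S : Finset n) : 0 ≤ (rowPiecewise S Q (1 - Q)).det := by
  set M := rowPiecewise S Q (1 - Q) with hM
  have hblock₁₁ : M.toBlock (· ∈ S) (· ∈ S) = Q.submatrix Subtype.val Subtype.val := by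
    ext x y
    simp [hM, rowPiecewise, x.2]
  have hblock₂₂ : M.toBlock (· ∉ S) (· ∉ S) = (1 - Q).submatrix Subtype.val Subtype.val := by
    ext x y
    simp [hM, rowPiecewise, x.2]
  have hblock₂₁ : M.toBlock (· ∉ S) (· ∈ S) = -(M.toBlock (· ∈ S) (· ∉ S))ᴴ := by
    ext x y
    simp [hM, rowPiecewise, x.2, y.2, (ne_of_mem_of_not_mem y.2 x.2).symm,
      ← hQ.1.apply x.1 y.1]
  rw [Matrix.det_toBlock _ (· ∈ S), hblock₁₁, hblock₂₂, hblock₂₁]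
  convert det_fromBlocks_nonneg (hQ.submatrix Subtype.val) (M.toBlock (· ∈ S) (· ∉ S))
    (hQ'.submatrix Subtype.val)

end Positivity

/-! ### Existence of discrete determinantal laws -/

section Bool

variable {F : Type*}

/-- The event that every site of `T` is occupied. -/
def occupied (T : Finset F) : Set (F → Bool) := {ω | ∀ x ∈ T, ω x = true}

theorem occupied_eq_biInter (T : Finset F) :
    occupied T = ⋂ x ∈ T, (fun ω : F → Bool => ω x) ⁻¹' {true} := by
  ext
  simp [occupied]

theorem measurableSet_occupied (T : Finset F) : MeasurableSet (occupied T) := by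
  rw [occupied_eq_biInter]
  exact Finset.measurableSet_biInter _ fun x _ => measurable_pi_apply x (measurableSet_singleton _)

theorem isClopen_occupied (T : Finset F) : IsClopen (occupied T) := by
  rw [occupied_eq_biInter]
  exact isClopen_biInter_finset fun x _ => (isClopen_discrete _).preimage (continuous_apply x)

/-- The principal minor of `Q` with rows and columns in `T`, as an extended nonnegative real. -/
def principalMinor [DecidableEq F] (Q : Matrix F F ℂ) (T : Finset F) : ℝ≥0∞ :=
  ENNReal.ofReal (Q.submatrix (Subtype.val : T → F) Subtype.val).det.re

variable [DecidableEq F]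

theorem exists_occupied_eq_principalMinor_of_finite [Finite F] {Q : Matrix F F ℂ}
    (hQ : Q.PosSemidef) (hQ' : (1 - Q).PosSemidef) :
    ∃ ν : ProbabilityMeasure (F → Bool), ∀ T,
      (ν : Measure (F → Bool)) (occupied T) = principalMinor Q T := by
  cases nonempty_fintype F
  let ν : Measure (F → Bool) := ∑ S : Finset F,
    ENNReal.ofReal (rowPiecewise S Q (1 - Q)).det.re • Measure.dirac fun x => decide (x ∈ S)
  have hν : ∀ T, ν (occupied T) = principalMinor Q T := fun T => by
    classical
    have hmem : ∀ S : Finset F, (fun x => decide (x ∈ S)) ∈ occupied T ↔ T ⊆ S := fun S => by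
      simp [occupied, Finset.subset_iff]
    rw [principalMinor, ← sum_det_rowPiecewise_of_subset, Complex.re_sum,
      ENNReal.ofReal_sum_of_nonneg fun S _ =>
        (Complex.le_def.1 (det_rowPiecewise_one_sub_nonneg hQ hQ' S)).1, Finset.sum_filter]
    simp only [ν, Measure.coe_finsetSum, Finset.sum_apply, Measure.smul_apply,
      Measure.dirac_apply' _ (measurableSet_occupied T), Set.indicator_apply, hmem, smul_eq_mul,
      Pi.one_apply, mul_ite, mul_one, mul_zero]
  exact ⟨⟨ν, ⟨by simpa [occupied, principalMinor] using hν ∅⟩⟩, hν⟩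

theorem principalMinor_subtype (Q : Matrix F F ℂ) {s T : Finset F} (hT : T ⊆ s) :
    principalMinor (Q.submatrix (Subtype.val : s → F) Subtype.val) (T.subtype (· ∈ s))
      = principalMinor Q T := by
  let e : T ≃ T.subtype (· ∈ s) :=
    { toFun := fun x => ⟨⟨x, hT x.2⟩, Finset.mem_subtype.2 x.2⟩
      invFun := fun x => ⟨x.1, Finset.mem_subtype.1 x.2⟩ }
  rw [principalMinor, ← Matrix.det_submatrix_equiv_self e]
  rfl

theorem ofReal_det_eq_principalMinor (Q : Matrix F F ℂ) {n : ℕ} {x : Fin n → F}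
    (hx : Function.Injective x) :
    ENNReal.ofReal (Matrix.of fun i j => Q (x i) (x j)).det.re
      = principalMinor Q (Finset.univ.image x) := by
  let e : Fin n ≃ Finset.univ.image x := (Equiv.ofInjective x hx).trans
    (Equiv.subtypeEquivRight fun y => by simp)
  rw [principalMinor, ← Matrix.det_submatrix_equiv_self e]
  rfl

theorem exists_occupied_eq_principalMinor_of_subset {Q : Matrix F F ℂ} (hQ : Q.PosSemidef)
    (hQ' : (1 - Q).PosSemidef) (s : Finset F) :
    ∃ ν : ProbabilityMeasure (F → Bool), ∀ T ⊆ s,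
      (ν : Measure (F → Bool)) (occupied T) = principalMinor Q T := by
  let extend : (s → Bool) → F → Bool := fun ω x => if h : x ∈ s then ω ⟨x, h⟩ else false
  have hextend : Measurable extend := measurable_pi_iff.2 fun x => by
    by_cases h : x ∈ s
    · simpa only [extend, h, dif_pos] using measurable_pi_apply _
    · simpa only [extend, h, dif_neg, not_false_eq_true] using measurable_const
  obtain ⟨ν, hν⟩ := exists_occupied_eq_principalMinor_of_finite
    (hQ.submatrix (Subtype.val : s → F)) (by
      rw [← Matrix.submatrix_one (Subtype.val : s → F) Subtype.val_injective]
      exact hQ'.submatrix (Subtype.val : s → F))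
  refine ⟨ν.map hextend.aemeasurable, fun T hT => ?_⟩
  have hpre : extend ⁻¹' occupied T = occupied (T.subtype (· ∈ s)) := by
    ext ω
    simp only [occupied, extend, Set.mem_preimage, Set.mem_ofPred_eq, Finset.mem_subtype]
    exact ⟨fun h x hx => by simpa using h x hx,
      fun h x hx => by simpa [hT hx] using h ⟨x, hT hx⟩ hx⟩
  rw [ProbabilityMeasure.toMeasure_map, Measure.map_apply hextend (measurableSet_occupied T), hpre,
    hν, principalMinor_subtype Q hT]

theorem exists_occupied_eq_principalMinor [Countable F] {Q : Matrix F F ℂ} (hQ : Q.PosSemidef)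
    (hQ' : (1 - Q).PosSemidef) :
    ∃ ν : ProbabilityMeasure (F → Bool), ∀ T,
      (ν : Measure (F → Bool)) (occupied T) = principalMinor Q T := by
  choose ν hν using exists_occupied_eq_principalMinor_of_subset hQ hQ'
  let 𝒰 : Ultrafilter (Finset F) := Ultrafilter.of atTop
  obtain ⟨ν', -, hν'⟩ := isCompact_univ.ultrafilter_le_nhds (𝒰.map ν) (by simp)
  refine ⟨ν', fun T => ?_⟩
  have hlim : Tendsto (fun s => (ν s : Measure (F → Bool)) (occupied T)) 𝒰
      (𝓝 ((ν' : Measure (F → Bool)) (occupied T))) := by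
    simp only [← ProbabilityMeasure.ennreal_coeFn_eq_coeFn_toMeasure]
    exact (ENNReal.continuous_coe.tendsto _).comp
      (ProbabilityMeasure.tendsto_measure_of_isClopen_of_tendsto hν' (isClopen_occupied T))
  have hconst : ∀ᶠ s in (𝒰 : Filter (Finset F)),
      (ν s : Measure (F → Bool)) (occupied T) = principalMinor Q T :=
    Ultrafilter.of_le _ ((eventually_ge_atTop T).mono fun s hs => hν s T hs)
  exact tendsto_nhds_unique (hlim.congr' hconst) tendsto_const_nhds

end Bool

instance sigmaFinite_config {E : Type*} [TopologicalSpace E] [SecondCountableTopology E]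
    [LocallyCompactSpace E] [MeasurableSpace E] (ξ : Config E) : SigmaFinite ξ.1 := by
  have := ξ.2.1
  infer_instance

section Discrete

variable {F : Type*} [Countable F] [TopologicalSpace F] [DiscreteTopology F] [MeasurableSpace F]
  [BorelSpace F]

/-- The configuration of the occupied sites. -/
noncomputable def boolConfig (ω : F → Bool) : Config F :=
  ⟨Measure.count.restrict {x | ω x = true},
    ⟨fun _ hs => (Measure.restrict_apply_le _ _).trans_lt
      (Measure.count_apply_lt_top.2 hs.finite_of_discrete)⟩,
    fun A hA => ⟨(A ∩ {x | ω x = true}).encard, by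
      rw [Measure.restrict_apply hA,
        Measure.count_apply (hA.inter (Set.to_countable _).measurableSet)]⟩⟩

theorem boolConfig_singleton (ω : F → Bool) (x : F) :
    (boolConfig ω).1 {x} = if ω x = true then 1 else 0 := by
  rw [boolConfig, Measure.restrict_apply (measurableSet_singleton x)]
  split_ifs with hx
  · rw [Set.inter_eq_left.2 (by simpa using hx), Measure.count_singleton]
  · rw [Set.singleton_inter_eq_empty.2 (by simpa using hx), measure_empty]

theorem measurable_boolConfig : Measurable (boolConfig (F := F)) := by
  refine Measurable.subtype_mk (Measure.measurable_of_measurable_coe _ fun A hA => ?_)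
  have hsum : ∀ ω : F → Bool, (boolConfig ω).1 A
      = ∑' x, A.indicator (fun x => if ω x = true then (1 : ℝ≥0∞) else 0) x := fun ω => by
    simp only [← Measure.tsum_indicator_apply_singleton _ A hA, boolConfig_singleton]
  change Measurable fun ω => (boolConfig ω).1 A
  simp only [hsum]
  refine Measurable.tsum fun x => ?_
  by_cases hx : x ∈ A
  · simp only [Set.indicator_of_mem hx]
    exact Measurable.ite (measurableSet_eq_fun (measurable_pi_apply x) measurable_const)
      measurable_const measurable_const
  · simp only [Set.indicator_of_notMem hx, measurable_const]

theorem pi_config_apply (ξ : Config F) {n : ℕ} (S : Set (Fin n → F)) :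
    Measure.pi (fun _ : Fin n => ξ.1) S
      = ∑' x, S.indicator (fun x : Fin n → F => ∏ a, ξ.1 {x a}) x := by
  rw [← Measure.tsum_indicator_apply_singleton _ S (Set.to_countable S).measurableSet]
  simp only [Measure.pi_singleton]

variable [DecidableEq F] {ν : Measure (F → Bool)} {Q : Matrix F F ℂ}

theorem lintegral_prod_boolConfig (hν : ∀ T, ν (occupied T) = principalMinor Q T) {n : ℕ}
    {x : Fin n → F} (hx : Function.Injective x) :
    ∫⁻ ω, ∏ a, (boolConfig ω).1 {x a} ∂ν
      = ENNReal.ofReal (Matrix.of fun i j => Q (x i) (x j)).det.re := by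
  classical
  rw [ofReal_det_eq_principalMinor Q hx, ← hν,
    ← lintegral_indicator_one (measurableSet_occupied _)]
  refine lintegral_congr fun ω => ?_
  simp only [boolConfig_singleton, Finset.prod_ite_zero]
  simp [Set.indicator_apply, occupied]

theorem isIntensity_map_boolConfig (hν : ∀ T, ν (occupied T) = principalMinor Q T) (n : ℕ) :
    IsIntensity Measure.count (ν.map boolConfig) n fun x =>
      ENNReal.ofReal (Matrix.of fun i j => Q (x i) (x j)).det.re := by
  intro S hS
  let f (x : Fin n → F) (ξ : Config F) : ℝ≥0∞ :=
    (S ∩ {x | Function.Injective x}).indicator (fun x => ∏ a, ξ.1 {x a}) x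
  have hf : ∀ x, Measurable (f x) := fun x => by
    by_cases hx : x ∈ S ∩ {x | Function.Injective x}
    · simp only [f, Set.indicator_of_mem hx]
      exact Finset.measurable_prod _ fun a _ =>
        (Measure.measurable_coe (measurableSet_singleton _)).comp measurable_subtype_coe
    · simp only [f, Set.indicator_of_notMem hx, measurable_const]
  have hpi : ∀ ξ : Config F,
      Measure.pi (fun _ : Fin n => ξ.1) (S ∩ {x | Function.Injective x}) = ∑' x, f x ξ :=
    fun ξ => pi_config_apply ξ _
  simp only [hpi]
  rw [lintegral_map (Measurable.tsum hf) measurable_boolConfig,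
    lintegral_tsum (f := fun x ω => f x (boolConfig ω))
      fun x => ((hf x).comp measurable_boolConfig).aemeasurable,
    ← lintegral_indicator hS, lintegral_countable']
  refine tsum_congr fun x => ?_
  simp only [Measure.pi_singleton, Measure.count_singleton, Finset.prod_const_one, mul_one]
  by_cases hxS : x ∈ S
  · rw [Set.indicator_of_mem hxS]
    by_cases hx : Function.Injective x
    · have hmem : x ∈ S ∩ {x | Function.Injective x} := ⟨hxS, hx⟩
      simp only [f, Set.indicator_of_mem hmem]
      exact lintegral_prod_boolConfig hν hx
    · have hmem : x ∉ S ∩ {x | Function.Injective x} := fun h => hx h.2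
      obtain ⟨i, j, hij, hne⟩ := Function.not_injective_iff.1 hx
      rw [Matrix.det_zero_of_row_eq hne (by ext; simp [hij])]
      simp [f, Set.indicator_of_notMem hmem]
  · have hmem : x ∉ S ∩ {x | Function.Injective x} := fun h => hxS h.1
    simp [f, Set.indicator_of_notMem hmem, Set.indicator_of_notMem hxS]

theorem exists_isDeterminantalWith_count (hQ : Q.PosSemidef)
    (hQ' : (1 - Q).PosSemidef) :
    ∃ P : Measure (Config F), IsDeterminantalWith Measure.count Q P := by
  obtain ⟨ν, hν⟩ := exists_occupied_eq_principalMinor hQ hQ'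
  refine ⟨(ν : Measure (F → Bool)).map boolConfig,
    Measure.isProbabilityMeasure_map measurable_boolConfig.aemeasurable,
    ae_all_iff.2 fun x => ?_, fun n _ => isIntensity_map_boolConfig hν n⟩
  have hx : Measurable fun ξ : Config F => ξ.1 {x} :=
    (Measure.measurable_coe (measurableSet_singleton x)).comp measurable_subtype_coe
  have hset : MeasurableSet {ξ : Config F | ξ.1 {x} = 0 ∨ ξ.1 {x} = 1} :=
    (measurableSet_eq_fun hx measurable_const).union (measurableSet_eq_fun hx measurable_const)
  rw [ae_map_iff measurable_boolConfig.aemeasurable hset]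
  refine Eventually.of_forall fun ω => ?_
  rw [boolConfig_singleton]
  split_ifs <;> simp

end Discrete

/-! ### Simple configurations as finite sums of Dirac measures -/

theorem finite_setOf_singleton_eq_one {E : Type*} [MeasurableSpace E] [MeasurableSingletonClass E]
    {ξ : Measure E} {D : Set E} (hD : ξ D ≠ ∞) :
    {x | x ∈ D ∧ ξ {x} = 1}.Finite := by
  by_contra hinf
  obtain ⟨n, hn⟩ := ENNReal.exists_nat_gt hD
  obtain ⟨t, ht, htn⟩ := Set.Infinite.exists_subset_card_eq hinf n
  have hξt : ξ (t : Set E) = n := by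
    rw [← sum_measure_singleton, Finset.sum_congr rfl fun x hx => (ht hx).2]
    simp [htn]
  exact (hn.trans_le (hξt ▸ measure_mono fun x hx => (ht hx).1)).false

section Configurations

variable {E : Type*} [TopologicalSpace E] [SecondCountableTopology E] [MeasurableSpace E]

theorem eq_zero_of_integer_of_forall_singleton [OpensMeasurableSpace E] {η : Measure E}
    [η.OuterRegular] (hint : ∀ A : Set E, MeasurableSet A → ∃ n : ℕ∞, η A = (n : ℝ≥0∞))
    (h0 : ∀ x, η {x} = 0) : η = 0 := by
  refine Measure.measure_univ_eq_zero.1 (measure_null_of_locally_null _ fun x _ => ?_)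
  obtain ⟨U, hxU, hU, hU_lt⟩ := Set.exists_isOpen_lt_of_lt {x} 1 (by rw [h0 x]; exact one_pos)
  obtain ⟨n, hn⟩ := hint U hU.measurableSet
  have hn0 : n = 0 := Order.lt_one_iff.1 (by exact_mod_cast hn ▸ hU_lt)
  exact ⟨U, mem_nhdsWithin_of_mem_nhds (hU.mem_nhds (hxU rfl)), by simp [hn, hn0]⟩

variable [TopologicalSpace.MetrizableSpace E] [BorelSpace E] {ξ : Measure E}

theorem measure_sdiff_singletons_eq_zero
    (hint : ∀ A : Set E, MeasurableSet A → ∃ n : ℕ∞, ξ A = (n : ℝ≥0∞))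
    (hs : ∀ x, ξ {x} = 0 ∨ ξ {x} = 1) {D : Set E} (hD : MeasurableSet D) (hfin : ξ D ≠ ∞) :
    ξ (D \ {x | x ∈ D ∧ ξ {x} = 1}) = 0 := by
  set S : Set E := {x | x ∈ D ∧ ξ {x} = 1}
  have hDS : MeasurableSet (D \ S) := hD.diff (finite_setOf_singleton_eq_one hfin).measurableSet
  have : IsFiniteMeasure (ξ.restrict (D \ S)) :=
    isFiniteMeasure_restrict.2 (measure_ne_top_of_subset Set.sdiff_subset hfin)
  rw [← Measure.restrict_eq_zero]
  refine eq_zero_of_integer_of_forall_singleton (fun A hA => ?_) fun x => ?_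
  · rw [Measure.restrict_apply hA]
    exact hint _ (hA.inter hDS)
  · rw [Measure.restrict_apply (measurableSet_singleton x)]
    by_cases hx : x ∈ D \ S
    · rw [Set.inter_eq_left.2 (Set.singleton_subset_iff.2 hx)]
      exact (hs x).resolve_right fun h => hx.2 ⟨hx.1, h⟩
    · rw [Set.singleton_inter_eq_empty.2 hx, measure_empty]

theorem exists_finset_restrict_eq_sum_dirac
    (hint : ∀ A : Set E, MeasurableSet A → ∃ n : ℕ∞, ξ A = (n : ℝ≥0∞))
    (hs : ∀ x, ξ {x} = 0 ∨ ξ {x} = 1) {D : Set E} (hD : MeasurableSet D) (hfin : ξ D ≠ ∞) :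
    ∃ S : Finset E, ξ.restrict D = ∑ x ∈ S, Measure.dirac x := by
  classical
  let S : Finset E := (finite_setOf_singleton_eq_one hfin).toFinset
  have hS : ∀ x, x ∈ S ↔ x ∈ D ∧ ξ {x} = 1 := fun x => by simp [S]
  refine ⟨S, Measure.ext fun A hA => ?_⟩
  have hnull : ξ ((A ∩ D) \ S) = 0 :=
    measure_mono_null (Set.sdiff_subset_sdiff_left Set.inter_subset_right)
      (by simpa [S] using measure_sdiff_singletons_eq_zero hint hs hD hfin)
  have hset : A ∩ D ∩ S = (S.filter (· ∈ A) : Finset E) := by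
    ext x
    have := hS x
    grind
  rw [Measure.restrict_apply hA, ← measure_inter_add_sdiff _ S.measurableSet, hnull, add_zero, hset,
    ← sum_measure_singleton, Finset.sum_filter, Measure.coe_finsetSum, Finset.sum_apply]
  refine Finset.sum_congr rfl fun x hx => ?_
  rw [Measure.dirac_apply' _ hA, Set.indicator_apply, ((hS x).1 hx).2, Pi.one_apply]

end Configurations

theorem pi_sum_dirac {E : Type*} [MeasurableSpace E] (S : Finset E) (n : ℕ) :
    Measure.pi (fun _ : Fin n => ∑ x ∈ S, Measure.dirac x)
      = ∑ f ∈ Fintype.piFinset (fun _ : Fin n => S), Measure.dirac f := by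
  classical
  refine Measure.pi_eq fun s hs => ?_
  simp only [Measure.coe_finsetSum, Finset.sum_apply, Finset.prod_univ_sum]
  refine Finset.sum_congr rfl fun f _ => ?_
  simp only [Measure.dirac_apply' _ (MeasurableSet.univ_pi hs), fun a => Measure.dirac_apply' (f a)
    (hs a), Set.indicator_apply, Pi.one_apply, Finset.prod_ite_zero, Finset.prod_const_one]
  simp

/-! ### Generating functions of counts -/

theorem card_filter_injective_image_eq {α : Type*} [DecidableEq α] {S t : Finset α} (hS : t ⊆ S)
    {n : ℕ} (ht : t.card = n) :
    (((Fintype.piFinset fun _ : Fin n => S).filter Function.Injective).filter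
      fun f => Finset.univ.image f = t).card = n ! := by
  have h : Fintype.card (Fin n ↪ t) = n ! := by
    rw [Fintype.card_embedding_eq, Fintype.card_coe, Fintype.card_fin, ht, Nat.descFactorial_self]
  rw [← h, ← Finset.card_univ]
  refine (Finset.card_bij (fun f _ a => (f a : α)) ?_ ?_ ?_).symm
  · intro f _
    have hinj : Function.Injective fun a => (f a : α) := Subtype.val_injective.comp f.injective
    simp only [Finset.mem_filter, Fintype.mem_piFinset]
    refine ⟨⟨fun a => hS (f a).2, hinj⟩, Finset.eq_of_subset_of_card_le (fun x hx => ?_) ?_⟩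
    · obtain ⟨a, -, rfl⟩ := Finset.mem_image.1 hx
      exact (f a).2
    · rw [Finset.card_image_of_injective _ hinj, Finset.card_fin, ht]
  · intro f _ g _ hfg
    ext a
    exact congrFun hfg a
  · intro f hf
    simp only [Finset.mem_filter] at hf
    exact ⟨⟨fun a => ⟨f a, hf.2 ▸ Finset.mem_image_of_mem _ (Finset.mem_univ a)⟩, fun a b hab =>
      hf.1.2 (congrArg Subtype.val hab)⟩, Finset.mem_univ _, rfl⟩

theorem sum_injective_prod_eq {α R : Type*} [DecidableEq α] [CommSemiring R] (S : Finset α)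
    (z : α → R) (n : ℕ) :
    ∑ f ∈ (Fintype.piFinset fun _ : Fin n => S).filter Function.Injective, ∏ a, z (f a)
      = n ! * ∑ t ∈ S.powersetCard n, ∏ x ∈ t, z x := by
  have hmaps : ∀ f ∈ (Fintype.piFinset fun _ : Fin n => S).filter Function.Injective,
      Finset.univ.image f ∈ S.powersetCard n := by
    intro f hf
    simp only [Finset.mem_filter, Fintype.mem_piFinset] at hf
    rw [Finset.mem_powersetCard, Finset.card_image_of_injective _ hf.2, Finset.card_fin]
    exact ⟨Finset.image_subset_iff.2 fun a _ => hf.1 a, rfl⟩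
  rw [← Finset.sum_fiberwise_of_maps_to hmaps, Finset.mul_sum]
  refine Finset.sum_congr rfl fun t ht => ?_
  rw [Finset.mem_powersetCard] at ht
  rw [← card_filter_injective_image_eq ht.1 ht.2, ← nsmul_eq_mul, ← Finset.sum_const]
  refine Finset.sum_congr rfl fun f hf => ?_
  simp only [Finset.mem_filter] at hf
  rw [← hf.2, Finset.prod_image fun a _ b _ h => hf.1.2 h]

theorem hasSum_prod_one_add {α R : Type*} [DecidableEq α] [Field R] [CharZero R]
    [TopologicalSpace R] (S : Finset α) (z : α → R) :
    HasSum (fun n : ℕ => (n ! : R)⁻¹ *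
      ∑ f ∈ (Fintype.piFinset fun _ : Fin n => S).filter Function.Injective, ∏ a, z (f a))
      (∏ x ∈ S, (1 + z x)) := by
  simp only [sum_injective_prod_eq,
    inv_mul_cancel_left₀ (Nat.cast_ne_zero (R := R).2 (Nat.factorial_ne_zero _))]
  rw [Finset.prod_one_add, Finset.sum_powerset]
  refine hasSum_sum_of_ne_finset_zero fun n hn => ?_
  rw [Finset.powersetCard_eq_empty.2 (by simpa using hn), Finset.sum_empty]

theorem prod_one_add_sum_ite {E ι R : Type*} [Fintype ι] [CommSemiring R] {A : ι → Set E}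
    (hA : Pairwise fun i j => Disjoint (A i) (A j)) (S : Finset E) (z : ι → R)
    [∀ i, DecidablePred (· ∈ A i)] :
    ∏ x ∈ S, (1 + ∑ i, if x ∈ A i then z i else 0)
      = ∏ i, (1 + z i) ^ (S.filter (· ∈ A i)).card := by
  have h : ∀ x, (1 + ∑ i, if x ∈ A i then z i else 0)
      = ∏ i, if x ∈ A i then 1 + z i else 1 := by
    intro x
    by_cases hx : ∃ i, x ∈ A i
    · obtain ⟨i, hi⟩ := hx
      have hne : ∀ j, j ≠ i → x ∉ A j := fun j hj hxj => (hA hj).le_bot ⟨hxj, hi⟩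
      rw [Fintype.sum_eq_single i fun j hj => if_neg (hne j hj),
        Fintype.prod_eq_single i fun j hj => if_neg (hne j hj), if_pos hi, if_pos hi]
    · push Not at hx
      simp only [hx, if_false, Finset.sum_const_zero, add_zero, Finset.prod_const_one]
  simp only [h]
  rw [Finset.prod_comm]
  refine Finset.prod_congr rfl fun i _ => ?_
  rw [← Finset.prod_filter, Finset.prod_const]

/-- The `n`-th term `(1 / n!) ∑ z (c 1) ⋯ z (c n) T c`, over the words `c` of length `n`, of the
exponential power series in the variables `z i` with coefficients `T`. Applied to factorial moments
of counts, the series is the generating function `𝔼 ∏ i, (1 + z i) ^ X (A i)`. -/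
noncomputable def expTerm {ι : Type*} [Fintype ι] (z : ι → ℂ) {n : ℕ}
    (T : (Fin n → ι) → ℝ≥0∞) : ℂ :=
  (n ! : ℂ)⁻¹ * ∑ c : Fin n → ι, (∏ a, z (c a)) * ((T c).toReal : ℂ)

/-- The set of tuples of distinct points whose `a`-th point lies in `A (c a)`. -/
def distinctTuples {E ι : Type*} (A : ι → Set E) {n : ℕ} (c : Fin n → ι) : Set (Fin n → E) :=
  Set.univ.pi (fun a => A (c a)) ∩ {x | Function.Injective x}

/-- The number of ordered tuples of distinct points of the configuration `ξ` whose `a`-th point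
lies in `A (c a)`. -/
noncomputable def tupleCount {E : Type*} [MeasurableSpace E] (ξ : Measure E) {ι : Type*}
    (A : ι → Set E) {n : ℕ} (c : Fin n → ι) : ℝ≥0∞ :=
  Measure.pi (fun _ : Fin n => ξ) (distinctTuples A c)

theorem measurableSet_distinctTuples {E : Type*} [MeasurableSpace E] [MeasurableEq E] {ι : Type*}
    {A : ι → Set E} (hAm : ∀ i, MeasurableSet (A i)) {n : ℕ} (c : Fin n → ι) :
    MeasurableSet (distinctTuples A c) := by
  refine (MeasurableSet.univ_pi fun a => hAm (c a)).inter ?_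
  simp only [Function.Injective, Set.ofPred_forall]
  refine MeasurableSet.iInter fun a => MeasurableSet.iInter fun b => ?_
  exact (measurableSet_eq_fun (measurable_pi_apply a) (measurable_pi_apply b)).imp
    (MeasurableSet.const (a = b))

theorem tupleCount_eq_pi_restrict {E ι : Type*} [MeasurableSpace E] (ξ : Measure E) [SigmaFinite ξ]
    (A : ι → Set E) {n : ℕ} (c : Fin n → ι) :
    tupleCount ξ A c
      = Measure.pi (fun _ : Fin n => ξ.restrict (⋃ i, A i)) (distinctTuples A c) := by
  have hsub : distinctTuples A c ⊆ Set.univ.pi fun _ => ⋃ i, A i :=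
    fun x hx a _ => Set.mem_iUnion_of_mem (c a) (hx.1 a trivial)
  rw [tupleCount, ← Measure.restrict_eq_self _ hsub, Measure.restrict_pi_pi]

theorem tupleCount_fin_one {E ι : Type*} [MeasurableSpace E] (ξ : Measure E) [SigmaFinite ξ]
    (A : ι → Set E) (i : ι) : tupleCount ξ A (fun _ : Fin 1 => i) = ξ (A i) := by
  have hinj : {x : Fin 1 → E | Function.Injective x} = Set.univ :=
    Set.eq_univ_of_forall fun x => Function.injective_of_subsingleton x
  rw [tupleCount, distinctTuples, hinj, Set.inter_univ, Measure.pi_pi, Fin.prod_univ_one]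

theorem measure_iUnion_lt_top_of_finite {E ι : Type*} [MeasurableSpace E] [Finite ι] {ξ : Measure E}
    {A : ι → Set E} (hfin : ∀ i, ξ (A i) ≠ ∞) : ξ (⋃ i, A i) < ∞ := by
  have := Fintype.ofFinite ι
  exact (measure_iUnion_fintype_le ξ A).trans_lt
    (ENNReal.sum_lt_top.2 fun i _ => (hfin i).lt_top)

theorem measurable_pi_const_measure {Ω E : Type*} [MeasurableSpace Ω] [MeasurableSpace E]
    {G : Ω → Measure E} [∀ ω, IsFiniteMeasure (G ω)] (hG : Measurable G) (n : ℕ) :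
    Measurable fun ω => Measure.pi fun _ : Fin n => G ω := by
  have hGs : ∀ s, MeasurableSet s → Measurable fun ω => G ω s := fun s hs =>
    (Measure.measurable_coe hs).comp hG
  refine Measurable.measure_of_isPiSystem generateFrom_pi.symm isPiSystem_pi ?_ ?_
  · rintro _ ⟨s, hs, rfl⟩
    simp only [Measure.pi_pi]
    exact Finset.measurable_prod _ fun a _ => hGs _ (hs a trivial)
  · simp only [Measure.pi_univ]
    exact Finset.measurable_prod _ fun a _ => hGs _ MeasurableSet.univ

theorem measurable_config_apply {E : Type*} [TopologicalSpace E] [MeasurableSpace E] {s : Set E}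
    (hs : MeasurableSet s) : Measurable fun ξ : Config E => ξ.1 s :=
  (Measure.measurable_coe hs).comp measurable_subtype_coe

section SumDirac

variable {E ι : Type*} [MeasurableSpace E] {ξ : Measure E} {A : ι → Set E} {S : Finset E}

theorem measure_eq_card_of_restrict_eq_sum_dirac [∀ i, DecidablePred (· ∈ A i)]
    (hAm : ∀ i, MeasurableSet (A i)) (hS : ξ.restrict (⋃ i, A i) = ∑ x ∈ S, Measure.dirac x)
    (i : ι) : ξ (A i) = (S.filter (· ∈ A i)).card := by
  rw [← Measure.restrict_eq_self ξ (Set.subset_iUnion A i), hS, Measure.coe_finsetSum,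
    Finset.sum_apply]
  simp only [Measure.dirac_apply' _ (hAm i), Set.indicator_apply, Pi.one_apply, Finset.sum_boole]

theorem toReal_tupleCount_of_restrict_eq_sum_dirac [MeasurableEq E] [DecidableEq E]
    [∀ i, DecidablePred (· ∈ A i)] [SigmaFinite ξ] (hAm : ∀ i, MeasurableSet (A i))
    (hS : ξ.restrict (⋃ i, A i) = ∑ x ∈ S, Measure.dirac x) {n : ℕ} (c : Fin n → ι) :
    (tupleCount ξ A c).toReal
      = ∑ f ∈ (Fintype.piFinset fun _ : Fin n => S).filter Function.Injective,
        if ∀ a, f a ∈ A (c a) then (1 : ℝ) else 0 := by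
  classical
  have hmem : ∀ f, f ∈ distinctTuples A c ↔ Function.Injective f ∧ ∀ a, f a ∈ A (c a) := fun f => by
    simp only [distinctTuples, Set.mem_inter_iff, Set.mem_univ_pi, Set.mem_ofPred_eq, and_comm]
  rw [tupleCount_eq_pi_restrict, hS, pi_sum_dirac, Measure.coe_finsetSum, Finset.sum_apply]
  simp only [Measure.dirac_apply' _ (measurableSet_distinctTuples hAm c), Set.indicator_apply, hmem,
    Pi.one_apply, Finset.sum_boole, ENNReal.toReal_natCast, Finset.filter_filter]

end SumDirac

section Counts

variable {E : Type*} [TopologicalSpace E] [SecondCountableTopology E]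
  [TopologicalSpace.MetrizableSpace E] [MeasurableSpace E] [BorelSpace E] {ι : Type*}

theorem hasSum_expTerm_tupleCount [Fintype ι] {ξ : Measure E} [SigmaFinite ξ]
    (hint : ∀ A : Set E, MeasurableSet A → ∃ n : ℕ∞, ξ A = (n : ℝ≥0∞))
    (hs : ∀ x, ξ {x} = 0 ∨ ξ {x} = 1) {A : ι → Set E}
    (hA : Pairwise fun i j => Disjoint (A i) (A j)) (hAm : ∀ i, MeasurableSet (A i))
    (hfin : ∀ i, ξ (A i) ≠ ∞) (z : ι → ℂ) :
    HasSum (fun n => expTerm z (tupleCount ξ A (n := n)))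
      (∏ i, (1 + z i) ^ ⌊(ξ (A i)).toReal⌋₊) := by
  classical
  obtain ⟨S, hS⟩ := exists_finset_restrict_eq_sum_dirac hint hs (MeasurableSet.iUnion hAm)
    (measure_iUnion_lt_top_of_finite hfin).ne
  have hterm : ∀ n, expTerm z (tupleCount ξ A (n := n)) = (n ! : ℂ)⁻¹ *
      ∑ f ∈ (Fintype.piFinset fun _ : Fin n => S).filter Function.Injective,
        ∏ a, ∑ i, if f a ∈ A i then z i else 0 := by
    intro n
    simp only [expTerm, toReal_tupleCount_of_restrict_eq_sum_dirac hAm hS, Complex.ofReal_sum]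
    refine congrArg _ ?_
    simp only [Finset.mul_sum]
    rw [Finset.sum_comm]
    refine Finset.sum_congr rfl fun f _ => ?_
    rw [Finset.prod_univ_sum, Fintype.piFinset_univ]
    refine Finset.sum_congr rfl fun c _ => ?_
    rw [Finset.prod_ite_zero]
    by_cases h : ∀ a, f a ∈ A (c a) <;> simp [h]
  simp only [hterm, measure_eq_card_of_restrict_eq_sum_dirac hAm hS, ENNReal.toReal_natCast,
    Nat.floor_natCast]
  rw [← prod_one_add_sum_ite hA S z]
  exact hasSum_prod_one_add S fun x => ∑ i, if x ∈ A i then z i else 0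

theorem aemeasurable_tupleCount [Finite ι] [LocallyCompactSpace E] {P : Measure (Config E)}
    {A : ι → Set E} (hAm : ∀ i, MeasurableSet (A i)) (hfin : ∀ᵐ ξ ∂P, ∀ i, ξ.1 (A i) ≠ ∞) {n : ℕ}
    (c : Fin n → ι) : AEMeasurable (fun ξ : Config E => tupleCount ξ.1 A c) P := by
  classical
  set D := ⋃ i, A i
  have hDm : MeasurableSet D := MeasurableSet.iUnion hAm
  let G : Config E → Measure E := fun ξ => if ξ.1 D < ∞ then ξ.1.restrict D else 0
  have hGfin : ∀ ξ, IsFiniteMeasure (G ξ) := fun ξ => by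
    by_cases h : ξ.1 D < ∞
    · simpa only [G, if_pos h] using isFiniteMeasure_restrict.2 h.ne
    · simp only [G, if_neg h]
      infer_instance
  have hG : Measurable G := Measurable.ite
    (measurableSet_lt (measurable_config_apply hDm) measurable_const)
    (Measure.measurable_of_measurable_coe _ fun s hs => by
      simpa only [Measure.restrict_apply hs] using measurable_config_apply (hs.inter hDm))
    measurable_const
  refine ⟨_, (Measure.measurable_coe (measurableSet_distinctTuples hAm c)).comp
    (measurable_pi_const_measure hG n), ?_⟩
  filter_upwards [hfin] with ξ hξ
  rw [tupleCount_eq_pi_restrict, Function.comp_apply]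
  simp only [G, if_pos (measure_iUnion_lt_top_of_finite hξ), D]

end Counts

section ExpTerm

variable {Ω ι : Type*} [MeasurableSpace Ω] [Fintype ι] {P : Measure Ω} {n : ℕ}
  {T : Ω → (Fin n → ι) → ℝ≥0∞}

theorem norm_expTerm_le (z : ι → ℂ) (T : (Fin n → ι) → ℝ≥0∞) :
    ‖expTerm z T‖ ≤ (n ! : ℝ)⁻¹ * ∑ c : Fin n → ι, (∏ a, ‖z (c a)‖) * (T c).toReal := by
  rw [expTerm, norm_mul, norm_inv, Complex.norm_natCast]
  gcongr
  refine (norm_sum_le _ _).trans_eq (Finset.sum_congr rfl fun c _ => ?_)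
  rw [norm_mul, norm_prod, Complex.norm_of_nonneg ENNReal.toReal_nonneg]

theorem integrable_expTerm (hT : ∀ c, AEMeasurable (fun ω => T ω c) P)
    (hT' : ∀ c, ∫⁻ ω, T ω c ∂P ≠ ∞) (z : ι → ℂ) : Integrable (fun ω => expTerm z (T ω)) P :=
  (integrable_finsetSum _ fun c _ =>
    (integrable_toReal_of_lintegral_ne_top (hT c) (hT' c)).ofReal.const_mul _).const_mul _

theorem integral_expTerm (hT : ∀ c, AEMeasurable (fun ω => T ω c) P)
    (hT' : ∀ c, ∫⁻ ω, T ω c ∂P ≠ ∞) (z : ι → ℂ) :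
    ∫ ω, expTerm z (T ω) ∂P = expTerm z fun c => ∫⁻ ω, T ω c ∂P := by
  have hint : ∀ c, Integrable (fun ω => ((T ω c).toReal : ℂ)) P := fun c =>
    (integrable_toReal_of_lintegral_ne_top (hT c) (hT' c)).ofReal
  simp only [expTerm]
  rw [integral_const_mul, integral_finsetSum _ fun c _ => (hint c).const_mul _]
  refine congrArg _ (Finset.sum_congr rfl fun c _ => ?_)
  rw [integral_const_mul, integral_complex_ofReal,
    integral_toReal (hT c) (ae_lt_top' (hT c) (hT' c))]

theorem integral_norm_expTerm_le (hT : ∀ c, AEMeasurable (fun ω => T ω c) P) {t : ι → NNReal}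
    (hTt : ∀ c, ∫⁻ ω, T ω c ∂P ≤ ∏ a, (t (c a) : ℝ≥0∞)) (z : ι → ℂ) :
    ∫ ω, ‖expTerm z (T ω)‖ ∂P ≤ (∑ i, ‖z i‖ * t i) ^ n / n ! := by
  have htop : ∀ c : Fin n → ι, ∏ a, (t (c a) : ℝ≥0∞) ≠ ∞ := fun c =>
    ENNReal.prod_ne_top fun a _ => ENNReal.coe_ne_top
  have hT' : ∀ c, ∫⁻ ω, T ω c ∂P ≠ ∞ := fun c => ne_top_of_le_ne_top (htop c) (hTt c)
  have hint : ∀ c, Integrable (fun ω => (∏ a, ‖z (c a)‖) * (T ω c).toReal) P := fun c =>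
    (integrable_toReal_of_lintegral_ne_top (hT c) (hT' c)).const_mul _
  calc ∫ ω, ‖expTerm z (T ω)‖ ∂P
      ≤ ∫ ω, (n ! : ℝ)⁻¹ * ∑ c, (∏ a, ‖z (c a)‖) * (T ω c).toReal ∂P :=
        integral_mono (integrable_expTerm hT hT' z).norm
          ((integrable_finsetSum _ fun c _ => hint c).const_mul _) fun ω => norm_expTerm_le z (T ω)
    _ = (n ! : ℝ)⁻¹ * ∑ c, (∏ a, ‖z (c a)‖) * (∫⁻ ω, T ω c ∂P).toReal := by
        rw [integral_const_mul, integral_finsetSum _ fun c _ => hint c]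
        refine congrArg _ (Finset.sum_congr rfl fun c _ => ?_)
        rw [integral_const_mul, integral_toReal (hT c) (ae_lt_top' (hT c) (hT' c))]
    _ ≤ (n ! : ℝ)⁻¹ * ∑ c : Fin n → ι, (∏ a, ‖z (c a)‖) * (∏ a, (t (c a) : ℝ≥0∞)).toReal := by
        gcongr with c
        · exact htop c
        · exact hTt c
    _ = (∑ i, ‖z i‖ * t i) ^ n / n ! := by
        simp only [ENNReal.toReal_prod, ENNReal.coe_toReal, ← Finset.prod_mul_distrib]
        rw [div_eq_inv_mul, Finset.sum_pow', Fintype.piFinset_univ]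

end ExpTerm

section CountVector

variable {E ι : Type*} [TopologicalSpace E] [MeasurableSpace E] {P : Measure (Config E)}
  {A : ι → Set E}

theorem config_apply_eq_natCast_floor (ξ : Config E) {s : Set E} (hs : MeasurableSet s)
    (hfin : ξ.1 s ≠ ∞) : ξ.1 s = ⌊(ξ.1 s).toReal⌋₊ := by
  obtain ⟨n, hn⟩ := ξ.2.2 s hs
  lift n to ℕ using fun h => hfin (by rw [hn, h]; rfl)
  simp [hn]

/-- The vector of the counts in the sets `A i`, as real numbers: characteristic functions are only
available in inner product spaces. The junk value of an infinite count is `0`. -/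
noncomputable def countVector (A : ι → Set E) (ξ : Config E) : EuclideanSpace ℝ ι :=
  WithLp.toLp 2 fun i => (ξ.1 (A i)).toReal

theorem measurable_countVector (hAm : ∀ i, MeasurableSet (A i)) : Measurable (countVector A) :=
  (WithLp.measurable_toLp 2 _).comp
    (measurable_pi_lambda _ fun i => (measurable_config_apply (hAm i)).ennreal_toReal)

theorem map_counts_eq_map_countVector (hAm : ∀ i, MeasurableSet (A i))
    (hfin : ∀ᵐ ξ ∂P, ∀ i, ξ.1 (A i) ≠ ∞) :
    P.map (fun ξ i => ξ.1 (A i))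
      = (P.map (countVector A)).map fun v i => ENNReal.ofReal (v i) := by
  rw [Measure.map_map (by fun_prop) (measurable_countVector hAm)]
  refine Measure.map_congr ?_
  filter_upwards [hfin] with ξ hξ
  ext i
  exact (ENNReal.ofReal_toReal (hξ i)).symm

theorem charFun_map_countVector [Fintype ι] (hAm : ∀ i, MeasurableSet (A i))
    (hfin : ∀ᵐ ξ ∂P, ∀ i, ξ.1 (A i) ≠ ∞) (θ : EuclideanSpace ℝ ι) :
    charFun (P.map (countVector A)) θ = ∫ ξ, ∏ i,
      (1 + (Complex.exp (θ i * Complex.I) - 1)) ^ ⌊(ξ.1 (A i)).toReal⌋₊ ∂P := by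
  rw [charFun_apply, integral_map (measurable_countVector hAm).aemeasurable (by fun_prop)]
  refine integral_congr_ae ?_
  filter_upwards [hfin] with ξ hξ
  simp only [countVector, PiLp.inner_apply, RCLike.inner_apply, conj_trivial, add_sub_cancel]
  rw [Complex.ofReal_sum, Finset.sum_mul, Complex.exp_sum]
  refine Finset.prod_congr rfl fun i _ => ?_
  have hcount : ((ξ.1 (A i)).toReal : ℂ) = (⌊(ξ.1 (A i)).toReal⌋₊ : ℂ) := by
    conv_lhs => rw [config_apply_eq_natCast_floor ξ (hAm i) (hξ i), ENNReal.toReal_natCast]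
    rfl
  rw [← Complex.exp_nat_mul, ← hcount]
  push_cast
  ring_nf

variable [SecondCountableTopology E] [LocallyCompactSpace E]

theorem ae_forall_config_apply_ne_top [Countable ι] (hAm : ∀ i, MeasurableSet (A i))
    (hM : ∀ i, ∫⁻ ξ, tupleCount ξ.1 A (fun _ : Fin 1 => i) ∂P ≠ ∞) :
    ∀ᵐ ξ ∂P, ∀ i, ξ.1 (A i) ≠ ∞ := by
  simp only [tupleCount_fin_one] at hM
  refine ae_all_iff.2 fun i => ?_
  filter_upwards [ae_lt_top (measurable_config_apply (hAm i)) (hM i)] with ξ hξ using hξ.ne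

theorem hasSum_expTerm_lintegral_tupleCount [TopologicalSpace.MetrizableSpace E] [BorelSpace E]
    [Fintype ι] (hs : ∀ᵐ ξ ∂P, ∀ x : E, ξ.1 {x} = 0 ∨ ξ.1 {x} = 1)
    (hA : Pairwise fun i j => Disjoint (A i) (A j)) (hAm : ∀ i, MeasurableSet (A i))
    {t : ι → NNReal}
    (hM : ∀ (n : ℕ) (c : Fin n → ι), ∫⁻ ξ, tupleCount ξ.1 A c ∂P ≤ ∏ a, (t (c a) : ℝ≥0∞))
    (z : ι → ℂ) :
    HasSum (fun n => expTerm z fun c : Fin n → ι => ∫⁻ ξ, tupleCount ξ.1 A c ∂P)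
      (∫ ξ, ∏ i, (1 + z i) ^ ⌊(ξ.1 (A i)).toReal⌋₊ ∂P) := by
  have hM' : ∀ (n : ℕ) (c : Fin n → ι), ∫⁻ ξ, tupleCount ξ.1 A c ∂P ≠ ∞ := fun n c =>
    ne_top_of_le_ne_top (ENNReal.prod_ne_top fun a _ => ENNReal.coe_ne_top) (hM n c)
  have hfin := ae_forall_config_apply_ne_top hAm fun i => hM' 1 fun _ => i
  have hT : ∀ (n : ℕ) (c : Fin n → ι), AEMeasurable (fun ξ : Config E => tupleCount ξ.1 A c) P :=
    fun n c => aemeasurable_tupleCount hAm hfin c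
  have hsum : Summable fun n => ∫ ξ : Config E, ‖expTerm z (tupleCount ξ.1 A (n := n))‖ ∂P :=
    Summable.of_nonneg_of_le (fun n => integral_nonneg fun ξ => norm_nonneg _)
      (fun n => integral_norm_expTerm_le (hT n) (hM n) z) (Real.summable_pow_div_factorial _)
  have hval : ∫ ξ, ∏ i, (1 + z i) ^ ⌊(ξ.1 (A i)).toReal⌋₊ ∂P
      = ∫ ξ : Config E, ∑' n, expTerm z (tupleCount ξ.1 A (n := n)) ∂P := by
    refine integral_congr_ae ?_
    filter_upwards [hfin, hs] with ξ hξ hξ'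
    exact (hasSum_expTerm_tupleCount ξ.2.2 hξ' hA hAm hξ z).tsum_eq.symm
  simp only [hval, ← integral_expTerm (hT _) (hM' _)]
  exact hasSum_integral_of_summable_integral_norm
    (fun n => integrable_expTerm (hT n) (hM' n) z) hsum

end CountVector

section Uniqueness

variable {E : Type*} [TopologicalSpace E] [SecondCountableTopology E]
  [TopologicalSpace.MetrizableSpace E] [LocallyCompactSpace E] [MeasurableSpace E] [BorelSpace E]
  {E' : Type*} [TopologicalSpace E'] [SecondCountableTopology E']
  [TopologicalSpace.MetrizableSpace E'] [LocallyCompactSpace E'] [MeasurableSpace E']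
  [BorelSpace E'] {P : Measure (Config E)} [IsProbabilityMeasure P] {P' : Measure (Config E')}
  [IsProbabilityMeasure P']

theorem map_counts_eq_of_lintegral_tupleCount_eq {ι : Type*} [Finite ι]
    (hs : ∀ᵐ ξ ∂P, ∀ x : E, ξ.1 {x} = 0 ∨ ξ.1 {x} = 1)
    (hs' : ∀ᵐ ξ ∂P', ∀ x : E', ξ.1 {x} = 0 ∨ ξ.1 {x} = 1) {A : ι → Set E} {A' : ι → Set E'}
    (hA : Pairwise fun i j => Disjoint (A i) (A j))
    (hA' : Pairwise fun i j => Disjoint (A' i) (A' j))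
    (hAm : ∀ i, MeasurableSet (A i)) (hAm' : ∀ i, MeasurableSet (A' i)) {t : ι → NNReal}
    (hM : ∀ (n : ℕ) (c : Fin n → ι), ∫⁻ ξ, tupleCount ξ.1 A c ∂P ≤ ∏ a, (t (c a) : ℝ≥0∞))
    (hMM : ∀ (n : ℕ) (c : Fin n → ι),
      ∫⁻ ξ, tupleCount ξ.1 A c ∂P = ∫⁻ ξ, tupleCount ξ.1 A' c ∂P') :
    P.map (fun ξ i => ξ.1 (A i)) = P'.map (fun ξ i => ξ.1 (A' i)) := by
  cases nonempty_fintype ι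
  have hM' : ∀ i, ∫⁻ ξ, tupleCount ξ.1 A (fun _ : Fin 1 => i) ∂P ≠ ∞ := fun i =>
    ne_top_of_le_ne_top (ENNReal.prod_ne_top fun a _ => ENNReal.coe_ne_top) (hM 1 fun _ => i)
  have hfin := ae_forall_config_apply_ne_top hAm hM'
  have hfin' := ae_forall_config_apply_ne_top hAm' fun i => (hMM 1 _).symm.trans_ne (hM' i)
  rw [map_counts_eq_map_countVector hAm hfin, map_counts_eq_map_countVector hAm' hfin']
  refine congrArg (Measure.map fun (v : EuclideanSpace ℝ ι) i => ENNReal.ofReal (v i)) ?_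
  have := Measure.isProbabilityMeasure_map (μ := P) (measurable_countVector hAm).aemeasurable
  have := Measure.isProbabilityMeasure_map (μ := P') (measurable_countVector hAm').aemeasurable
  refine Measure.ext_of_charFun (funext fun θ => ?_)
  rw [charFun_map_countVector hAm hfin, charFun_map_countVector hAm' hfin']
  refine (hasSum_expTerm_lintegral_tupleCount hs hA hAm hM _).unique ?_
  simp only [hMM]
  exact hasSum_expTerm_lintegral_tupleCount hs' hA' hAm' (fun n c => (hMM n c).ge.trans (hM n c)) _

theorem jointCountLaw_eq_of_lintegral_tupleCount_eq
    (hs : ∀ᵐ ξ ∂P, ∀ x : E, ξ.1 {x} = 0 ∨ ξ.1 {x} = 1)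
    (hs' : ∀ᵐ ξ ∂P', ∀ x : E', ξ.1 {x} = 0 ∨ ξ.1 {x} = 1) {A : ℕ → Set E} {A' : ℕ → Set E'}
    (hA : Pairwise fun i j => Disjoint (A i) (A j))
    (hA' : Pairwise fun i j => Disjoint (A' i) (A' j))
    (hAm : ∀ i, MeasurableSet (A i)) (hAm' : ∀ i, MeasurableSet (A' i)) {t : ℕ → NNReal}
    (hM : ∀ (n : ℕ) (c : Fin n → ℕ), ∫⁻ ξ, tupleCount ξ.1 A c ∂P ≤ ∏ a, (t (c a) : ℝ≥0∞))
    (hMM : ∀ (n : ℕ) (c : Fin n → ℕ),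
      ∫⁻ ξ, tupleCount ξ.1 A c ∂P = ∫⁻ ξ, tupleCount ξ.1 A' c ∂P') :
    jointCountLaw P A = jointCountLaw P' A' := by
  have hm : Measurable fun (ξ : Config E) i => ξ.1 (A i) :=
    measurable_pi_lambda _ fun i => measurable_config_apply (hAm i)
  have hm' : Measurable fun (ξ : Config E') i => ξ.1 (A' i) :=
    measurable_pi_lambda _ fun i => measurable_config_apply (hAm' i)
  have : IsProbabilityMeasure (jointCountLaw P A) :=
    Measure.isProbabilityMeasure_map hm.aemeasurable
  refine IsProjectiveLimit.unique (P := fun I => (jointCountLaw P A).map I.restrict)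
    (fun I => rfl) (fun I => ?_)
  change (P'.map _).map I.restrict = (P.map _).map I.restrict
  rw [Measure.map_map (by fun_prop) hm, Measure.map_map (by fun_prop) hm']
  exact (map_counts_eq_of_lintegral_tupleCount_eq (ι := I) (A := fun i => A i)
    (A' := fun i => A' i) hs hs' (fun i j hij => hA (Subtype.coe_ne_coe.2 hij))
    (fun i j hij => hA' (Subtype.coe_ne_coe.2 hij)) (fun i => hAm i) (fun i => hAm' i)
    (t := fun i => t i) (fun n c => hM n fun a => c a) fun n c => hMM n fun a => c a).symm

end Uniqueness

/-! ### Gram kernels -/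

theorem lintegral_fin_nat_prod_eq_prod {n : ℕ} {E : Fin n → Type*} [∀ i, MeasurableSpace (E i)]
    (μ : ∀ i, Measure (E i)) [∀ i, SigmaFinite (μ i)] {f : ∀ i, E i → ℝ≥0∞}
    (hf : ∀ i, Measurable (f i)) :
    ∫⁻ x, ∏ i, f i (x i) ∂(Measure.pi μ) = ∏ i, ∫⁻ x, f i x ∂(μ i) := by
  induction n with
  | zero => simp
  | succ n ih =>
    have htail : Measurable fun y : ∀ i : Fin n, E i.succ => ∏ i, f i.succ (y i) :=
      Finset.measurable_prod _ fun i _ => (hf _).comp (measurable_pi_apply i)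
    rw [← ((measurePreserving_piFinSuccAbove μ 0).symm).lintegral_comp_emb
      (MeasurableEquiv.measurableEmbedding _), Fin.prod_univ_succ,
      ← ih (fun i => μ i.succ) fun i => hf i.succ,
      ← lintegral_prod_mul (hf 0).aemeasurable htail.aemeasurable]
    exact lintegral_congr fun p => Fin.prod_univ_succ _

theorem quasiMeasurePreserving_eval_pair {n : ℕ} {E : Fin n → Type*} [∀ i, MeasurableSpace (E i)]
    (μ : ∀ i, Measure (E i)) [∀ i, SigmaFinite (μ i)] {a b : Fin n} (hab : a ≠ b) :
    Measure.QuasiMeasurePreserving (fun x : ∀ i, E i => (x a, x b))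
      (Measure.pi μ) ((μ a).prod (μ b)) := by
  cases n with
  | zero => exact a.elim0
  | succ n =>
    obtain ⟨b', rfl⟩ := Fin.exists_succAbove_eq hab.symm
    have hfst := (measurePreserving_piFinSuccAbove μ a).quasiMeasurePreserving
    have hsnd := Measure.quasiMeasurePreserving_eval (fun j => μ (a.succAbove j)) b'
    have hprod : Measure.QuasiMeasurePreserving (Prod.map id (Function.eval b'))
        ((μ a).prod (Measure.pi fun j => μ (a.succAbove j)))
        ((μ a).prod (μ (a.succAbove b'))) := by
      refine ⟨by fun_prop, ?_⟩
      rw [← Measure.map_prod_map _ _ measurable_id (measurable_pi_apply b'), Measure.map_id]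
      exact Measure.AbsolutelyContinuous.rfl.prod hsnd.absolutelyContinuous
    exact hprod.comp hfst

section GramMatrix

variable {E J m : Type*}

/-- The matrix of the truncated kernel `∑ j ∈ s, v j x * conj (v j y)` at the points `x`. -/
noncomputable def gramMatrix (v : J → E → ℂ) (s : Finset J) (x : m → E) : Matrix m m ℂ :=
  Matrix.of fun a b => ∑ j ∈ s, v j (x a) * conj (v j (x b))

theorem posSemidef_gramMatrix [Finite m] (v : J → E → ℂ) (s : Finset J) (x : m → E) :
    (gramMatrix v s x).PosSemidef := by
  have hmul : gramMatrix v s x = (Matrix.of fun (a : m) (j : s) => v j (x a)) *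
      (Matrix.of fun (a : m) (j : s) => v j (x a))ᴴ := by
    ext a b
    rw [gramMatrix, Matrix.mul_apply, Matrix.of_apply, ← Finset.sum_coe_sort]
    rfl
  rw [hmul]
  exact Matrix.posSemidef_self_mul_conjTranspose _

variable [Fintype m]

theorem integrable_prod_mul_conj [MeasurableSpace E] {ι : Type*} {μ : Measure E} [SigmaFinite μ]
    {v : J → E → ℂ} {A : ι → Set E} (hv : ∀ i j, MemLp (v j) 2 (μ.restrict (A i)))
    (c : m → ι) (f g : m → J) :
    Integrable (fun x : m → E => ∏ a, (v (f a) (x a) * conj (v (g a) (x a))))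
      (Measure.pi fun a => μ.restrict (A (c a))) :=
  Integrable.fintype_prod (f := fun a y => v (f a) y * conj (v (g a) y))
    fun a => (hv (c a) (f a)).integrable_mul (hv (c a) (g a)).star

variable [DecidableEq m]

theorem ofReal_det_gramMatrix_le (v : J → E → ℂ) (s : Finset J) (x : m → E) :
    ENNReal.ofReal (gramMatrix v s x).det.re ≤ ∏ a, ∑' j, ‖v j (x a)‖ₑ ^ 2 := by
  have hdiag : ∀ a, gramMatrix v s x a a = ((∑ j ∈ s, ‖v j (x a)‖ ^ 2 : ℝ) : ℂ) := fun a => by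
    simp only [gramMatrix, Matrix.of_apply, Complex.mul_conj']
    norm_cast
  have hle : (gramMatrix v s x).det.re ≤ ∏ a, ∑ j ∈ s, ‖v j (x a)‖ ^ 2 := by
    have h := det_le_prod_diag (posSemidef_gramMatrix v s x)
    simp only [hdiag] at h
    exact_mod_cast (Complex.le_def.1 h).1
  refine (ENNReal.ofReal_le_ofReal hle).trans ?_
  rw [ENNReal.ofReal_prod_of_nonneg fun a _ => Finset.sum_nonneg fun j _ => sq_nonneg _]
  refine Finset.prod_le_prod' fun a _ => ?_
  rw [ENNReal.ofReal_sum_of_nonneg fun j _ => sq_nonneg _]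
  simp only [ENNReal.ofReal_pow (norm_nonneg _), ofReal_norm]
  exact ENNReal.sum_le_tsum s

theorem det_gramMatrix_eq_sum (v : J → E → ℂ) (s : Finset J) (x : m → E) :
    (gramMatrix v s x).det = ∑ σ : Equiv.Perm m, ((Equiv.Perm.sign σ : ℤ) : ℂ) *
      ∑ f ∈ Fintype.piFinset fun _ : m => s,
        ∏ a, (v (f (σ.symm a)) (x a) * conj (v (f a) (x a))) := by
  rw [Matrix.det_apply']
  refine Finset.sum_congr rfl fun σ _ => congrArg _ ?_
  simp only [gramMatrix, Matrix.of_apply]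
  rw [Finset.prod_univ_sum]
  refine Finset.sum_congr rfl fun f _ => ?_
  rw [Finset.prod_mul_distrib, Finset.prod_mul_distrib,
    ← Equiv.prod_comp σ fun a => v (f (σ.symm a)) (x a)]
  simp only [Equiv.symm_apply_apply]

theorem measurable_det_gramMatrix [MeasurableSpace E] {v : J → E → ℂ} (hv : ∀ j, Measurable (v j))
    (s : Finset J) : Measurable fun x : m → E => (gramMatrix v s x).det := by
  have (j : J) (a : m) : Measurable fun x : m → E => v j (x a) :=
    (hv j).comp (measurable_pi_apply a)
  simp only [det_gramMatrix_eq_sum]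
  fun_prop

/-- The value of the integral of `det (gramMatrix v s)` over a product of sets `A (c a)`, in terms
of the Gram numbers `G i j l = ∫ x in A i, v j x * conj (v l x)`. -/
noncomputable def gramSum {ι : Type*} (G : ι → J → J → ℂ) (s : Finset J) (c : m → ι) : ℂ :=
  ∑ σ : Equiv.Perm m, ((Equiv.Perm.sign σ : ℤ) : ℂ) *
    ∑ f ∈ Fintype.piFinset fun _ : m => s, ∏ a, G (c a) (f (σ.symm a)) (f a)

variable [MeasurableSpace E] {ι : Type*} {μ : Measure E} [SigmaFinite μ] {v : J → E → ℂ}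
  {A : ι → Set E}

theorem integrable_det_gramMatrix (hv : ∀ i j, MemLp (v j) 2 (μ.restrict (A i))) (s : Finset J)
    (c : m → ι) : Integrable (fun x : m → E => (gramMatrix v s x).det)
      (Measure.pi fun a => μ.restrict (A (c a))) := by
  simp only [det_gramMatrix_eq_sum]
  exact integrable_finsetSum _ fun σ _ => (integrable_finsetSum _ fun f _ =>
    integrable_prod_mul_conj hv c _ _).const_mul _

theorem integral_det_gramMatrix (hv : ∀ i j, MemLp (v j) 2 (μ.restrict (A i))) (s : Finset J)
    (c : m → ι) :
    ∫ x, (gramMatrix v s x).det ∂(Measure.pi fun a => μ.restrict (A (c a)))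
      = gramSum (fun i j l => ∫ x in A i, v j x * conj (v l x) ∂μ) s c := by
  have hint := integrable_prod_mul_conj hv c
  simp only [det_gramMatrix_eq_sum]
  rw [integral_finsetSum _
    fun σ _ => (integrable_finsetSum _ fun f _ => hint _ _).const_mul _]
  refine Finset.sum_congr rfl fun σ _ => ?_
  rw [integral_const_mul, integral_finsetSum _ fun f _ => hint _ _]
  refine congrArg _ (Finset.sum_congr rfl fun f _ => ?_)
  exact integral_fintype_prod_eq_prod (fun a y => v (f (σ.symm a)) y * conj (v (f a) y))

theorem lintegral_det_gramMatrix (hv : ∀ i j, MemLp (v j) 2 (μ.restrict (A i))) (s : Finset J)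
    (c : m → ι) :
    ∫⁻ x in Set.univ.pi fun a => A (c a),
      ENNReal.ofReal (gramMatrix v s x).det.re ∂(Measure.pi fun _ : m => μ)
    = ENNReal.ofReal (gramSum (fun i j l => ∫ x in A i, v j x * conj (v l x) ∂μ) s c).re := by
  have hint := integrable_det_gramMatrix hv s c
  have hre : Integrable (fun x : m → E => (gramMatrix v s x).det.re)
    (Measure.pi fun a => μ.restrict (A (c a))) := hint.re
  rw [Measure.restrict_pi_pi, ← integral_det_gramMatrix hv,
    ← ofReal_integral_eq_lintegral_ofReal hre (Filter.Eventually.of_forall fun x =>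
      (Complex.le_def.1 (posSemidef_gramMatrix v s x).det_nonneg).1)]
  exact congrArg _ (integral_re hint)

end GramMatrix

section Gram

variable {E : Type*} [MeasurableSpace E]

/-- The integral of the `n`-point determinantal intensity over a product of sets. -/
noncomputable def detMoment {ι : Type*} (μ : Measure E) (k : E → E → ℂ) (A : ι → Set E) {n : ℕ}
    (c : Fin n → ι) : ℝ≥0∞ :=
  ∫⁻ x in Set.univ.pi (fun a => A (c a)),
    ENNReal.ofReal (Matrix.det (Matrix.of fun i j => k (x i) (x j))).re
      ∂(Measure.pi fun _ : Fin n => μ)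

theorem lintegral_tupleCount [TopologicalSpace E] {ι : Type*} {μ : Measure E} {k : E → E → ℂ}
    {P : Measure (Config E)} (hP : IsDeterminantalWith μ k P) {A : ι → Set E}
    (hAm : ∀ i, MeasurableSet (A i)) {n : ℕ} (c : Fin n → ι) :
    ∫⁻ ξ, tupleCount ξ.1 A c ∂P = detMoment μ k A c := by
  rcases Nat.eq_zero_or_pos n with rfl | hn
  · have := hP.isProbabilityMeasure
    have hinj : {x : Fin 0 → E | Function.Injective x} = Set.univ :=
      Set.eq_univ_of_forall fun x => Function.injective_of_subsingleton x
    simp [tupleCount, distinctTuples, detMoment, hinj]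
  · exact hP.intensity n hn _ (MeasurableSet.univ_pi fun a => hAm (c a))

/-- The functions `v j` represent `k` as the kernel `∑ j, v j x * conj (v j y)`. The diagonal, which
may be a null set for `μ.prod μ`, is treated separately. -/
structure IsGram {J : Type*} (μ : Measure E) (k : E → E → ℂ) (v : J → E → ℂ) : Prop where
  measurable : ∀ j, Measurable (v j)
  off_diagonal : ∀ᵐ p ∂μ.prod μ, HasSum (fun j => v j p.1 * conj (v j p.2)) (k p.1 p.2)
  diagonal : ∀ᵐ x ∂μ, HasSum (fun j => v j x * conj (v j x)) (k x x)

namespace IsGram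

variable {ι J : Type*} {μ : Measure E} [SigmaFinite μ] {k : E → E → ℂ} {v : J → E → ℂ}
  {A : ι → Set E} {n : ℕ}

theorem ae_tendsto (h : IsGram μ k v) (n : ℕ) :
    ∀ᵐ x ∂(Measure.pi fun _ : Fin n => μ),
      Tendsto (fun s => ENNReal.ofReal (gramMatrix v s x).det.re) atTop
        (𝓝 (ENNReal.ofReal (Matrix.det (Matrix.of fun i j => k (x i) (x j))).re)) := by
  have hall : ∀ᵐ x ∂(Measure.pi fun _ : Fin n => μ), ∀ a b,
      HasSum (fun j => v j (x a) * conj (v j (x b))) (k (x a) (x b)) := by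
    simp only [ae_all_iff]
    intro a b
    rcases eq_or_ne a b with rfl | hab
    · exact (Measure.quasiMeasurePreserving_eval (fun _ : Fin n => μ) a).ae h.diagonal
    · exact (quasiMeasurePreserving_eval_pair (fun _ : Fin n => μ) hab).ae h.off_diagonal
  filter_upwards [hall] with x hx
  have hM : Tendsto (fun s => gramMatrix v s x) atTop (𝓝 (Matrix.of fun i j => k (x i) (x j))) :=
    tendsto_pi_nhds.2 fun a => tendsto_pi_nhds.2 fun b => hx a b
  have hc : Continuous fun M : Matrix (Fin n) (Fin n) ℂ => ENNReal.ofReal M.det.re :=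
    ENNReal.continuous_ofReal.comp (Complex.continuous_re.comp continuous_id.matrix_det)
  exact (hc.tendsto _).comp hM

variable [Countable J]

theorem setLIntegral_prod_tsum (h : IsGram μ k v) (A : ι → Set E) (c : Fin n → ι) :
    ∫⁻ x in Set.univ.pi fun a => A (c a), ∏ a, ∑' j, ‖v j (x a)‖ₑ ^ 2
      ∂(Measure.pi fun _ : Fin n => μ) = ∏ a, ∫⁻ x in A (c a), ∑' j, ‖v j x‖ₑ ^ 2 ∂μ := by
  rw [Measure.restrict_pi_pi]
  exact lintegral_fin_nat_prod_eq_prod (fun a => μ.restrict (A (c a)))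
    (f := fun _ x => ∑' j, ‖v j x‖ₑ ^ 2)
    fun _ => Measurable.tsum fun j => (h.measurable j).enorm.pow_const 2

theorem tendsto_detMoment (h : IsGram μ k v)
    (hfin : ∀ i, ∫⁻ x in A i, ∑' j, ‖v j x‖ₑ ^ 2 ∂μ ≠ ∞) (c : Fin n → ι) :
    Tendsto (fun s => ∫⁻ x in Set.univ.pi fun a => A (c a),
      ENNReal.ofReal (gramMatrix v s x).det.re ∂(Measure.pi fun _ : Fin n => μ)) atTop
      (𝓝 (detMoment μ k A c)) := by
  refine tendsto_lintegral_filter_of_dominated_convergence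
    (fun x => ∏ a, ∑' j, ‖v j (x a)‖ₑ ^ 2) ?_ ?_ ?_ (ae_restrict_of_ae (h.ae_tendsto n))
  · exact .of_forall fun s => ENNReal.measurable_ofReal.comp
      (Complex.measurable_re.comp (measurable_det_gramMatrix h.measurable s))
  · exact .of_forall fun s => .of_forall fun x => ofReal_det_gramMatrix_le v s x
  · rw [h.setLIntegral_prod_tsum]
    exact ENNReal.prod_ne_top fun a _ => hfin (c a)

theorem detMoment_le (h : IsGram μ k v)
    (hfin : ∀ i, ∫⁻ x in A i, ∑' j, ‖v j x‖ₑ ^ 2 ∂μ ≠ ∞) (c : Fin n → ι) :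
    detMoment μ k A c ≤ ∏ a, ∫⁻ x in A (c a), ∑' j, ‖v j x‖ₑ ^ 2 ∂μ := by
  rw [← h.setLIntegral_prod_tsum]
  exact le_of_tendsto' (h.tendsto_detMoment hfin c) fun s =>
    lintegral_mono fun x => ofReal_det_gramMatrix_le v s x

theorem tendsto_ofReal_gramSum (h : IsGram μ k v)
    (hfin : ∀ i, ∫⁻ x in A i, ∑' j, ‖v j x‖ₑ ^ 2 ∂μ ≠ ∞) (c : Fin n → ι) :
    Tendsto (fun s => ENNReal.ofReal
      (gramSum (fun i j l => ∫ x in A i, v j x * conj (v l x) ∂μ) s c).re) atTop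
      (𝓝 (detMoment μ k A c)) := by
  have hLp : ∀ i j, MemLp (v j) 2 (μ.restrict (A i)) := fun i j => by
    refine ⟨(h.measurable j).aestronglyMeasurable, ?_⟩
    rw [eLpNorm_lt_top_iff_lintegral_rpow_enorm_lt_top two_ne_zero ENNReal.ofNat_ne_top]
    simpa using (lintegral_mono fun x => ENNReal.le_tsum j).trans_lt (hfin i).lt_top
  simpa only [lintegral_det_gramMatrix hLp] using h.tendsto_detMoment hfin c

end IsGram

end Gram

section Comparison

variable {E : Type*} [TopologicalSpace E] [SecondCountableTopology E]
  [TopologicalSpace.MetrizableSpace E] [LocallyCompactSpace E] [MeasurableSpace E] [BorelSpace E]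
  {E' : Type*} [TopologicalSpace E'] [SecondCountableTopology E']
  [TopologicalSpace.MetrizableSpace E'] [LocallyCompactSpace E'] [MeasurableSpace E']
  [BorelSpace E'] {μ : Measure E} [SigmaFinite μ] {k : E → E → ℂ} {P : Measure (Config E)}
  {μ' : Measure E'} [SigmaFinite μ'] {k' : E' → E' → ℂ} {P' : Measure (Config E')}
  {J : Type*} [Countable J] {v : J → E → ℂ} {v' : J → E' → ℂ}

theorem jointCountLaw_eq_of_isGram (hP : IsDeterminantalWith μ k P)
    (hP' : IsDeterminantalWith μ' k' P') (h : IsGram μ k v) (h' : IsGram μ' k' v')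
    {A : ℕ → Set E} {A' : ℕ → Set E'} (hA : Pairwise fun i j => Disjoint (A i) (A j))
    (hA' : Pairwise fun i j => Disjoint (A' i) (A' j))
    (hAm : ∀ i, MeasurableSet (A i)) (hAm' : ∀ i, MeasurableSet (A' i))
    (hfin : ∀ i, ∫⁻ x in A i, ∑' j, ‖v j x‖ₑ ^ 2 ∂μ ≠ ∞)
    (hfin' : ∀ i, ∫⁻ x in A' i, ∑' j, ‖v' j x‖ₑ ^ 2 ∂μ' ≠ ∞)
    (hG : ∀ i j l, ∫ x in A i, v j x * conj (v l x) ∂μ = ∫ x in A' i, v' j x * conj (v' l x) ∂μ') :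
    jointCountLaw P A = jointCountLaw P' A' := by
  have := hP.isProbabilityMeasure
  have := hP'.isProbabilityMeasure
  refine jointCountLaw_eq_of_lintegral_tupleCount_eq hP.simple hP'.simple hA hA' hAm hAm'
    (t := fun i => (∫⁻ x in A i, ∑' j, ‖v j x‖ₑ ^ 2 ∂μ).toNNReal) (fun n c => ?_) fun n c => ?_
  · simpa only [lintegral_tupleCount hP hAm, ENNReal.coe_toNNReal (hfin _)]
      using h.detMoment_le hfin c
  · rw [lintegral_tupleCount hP hAm, lintegral_tupleCount hP' hAm']
    refine tendsto_nhds_unique (h.tendsto_ofReal_gramSum hfin c) ?_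
    simpa only [hG] using h'.tendsto_ofReal_gramSum hfin' c

end Comparison

/-! ### Operators on Hilbert spaces -/

section Hilbert

variable {H J : Type*} [NormedAddCommGroup H] [InnerProductSpace ℂ H]

theorem tsum_enorm_inner_sq (b : HilbertBasis J ℂ H) (x : H) :
    ∑' j, ‖inner ℂ (b j) x‖ₑ ^ 2 = ‖x‖ₑ ^ 2 := by
  have hreal : HasSum (fun j => ‖inner ℂ (b j) x‖ ^ 2) (‖x‖ ^ 2) := by
    have hterm : ∀ j, (inner ℂ x (b j) * inner ℂ (b j) x).re = ‖inner ℂ (b j) x‖ ^ 2 := fun j => by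
      rw [← RCLike.re_to_complex, inner_mul_symm_re_eq_norm, norm_mul, norm_inner_symm, sq]
    have hself : (inner ℂ x x).re = ‖x‖ ^ 2 := inner_self_eq_norm_sq (𝕜 := ℂ) x
    simpa only [hterm, hself] using Complex.hasSum_re (b.hasSum_inner_mul_inner x x)
  simp only [← ofReal_norm, ← ENNReal.ofReal_pow (norm_nonneg _)]
  rw [← hreal.tsum_eq, ENNReal.ofReal_tsum_of_nonneg (fun j => sq_nonneg _) hreal.summable]

theorem countable_of_orthonormal [TopologicalSpace.SeparableSpace H] {v : J → H}
    (hv : Orthonormal ℂ v) : Countable J := by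
  refine Pairwise.countable_of_isOpen_disjoint (s := fun j => Metric.ball (v j) (1 / 2))
    (fun i j hij => Metric.ball_disjoint_ball ?_) (fun j => Metric.isOpen_ball)
    fun j => Metric.nonempty_ball.2 one_half_pos
  have hdist : ‖v i - v j‖ ^ 2 = 2 := by
    rw [@norm_sub_sq ℂ, hv.1, hv.1, hv.2 hij]
    norm_num
  rw [dist_eq_norm]
  nlinarith [norm_nonneg (v i - v j)]

variable [CompleteSpace H]

theorem exists_isSelfAdjoint_comp_self_eq {K : H →L[ℂ] H} (hK : K.IsPositive) :
    ∃ R : H →L[ℂ] H, IsSelfAdjoint R ∧ R ∘L R = K :=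
  ⟨CFC.sqrt K, (CFC.sqrt_nonneg K).isSelfAdjoint,
    CFC.sqrt_mul_sqrt_self K ((ContinuousLinearMap.nonneg_iff_isPositive K).2 hK)⟩

theorem hasSum_inner_mul_conj_inner (b : HilbertBasis J ℂ H) {R : H →L[ℂ] H}
    (hR : IsSelfAdjoint R) (x y : H) :
    HasSum (fun j => inner ℂ x (R (b j)) * conj (inner ℂ y (R (b j)))) (inner ℂ x (R (R y))) := by
  have h := b.hasSum_inner_mul_inner (R x) (R y)
  simpa only [inner_conj_symm, hR.isSymmetric.apply_clm] using h

theorem traceAlong_compress {I : Type*} {R p : H →L[ℂ] H} (hR : IsSelfAdjoint R)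
    (hp : IsSelfAdjoint p) (w : HilbertBasis I ℂ H) (b : HilbertBasis J ℂ H) :
    traceAlong w (p ∘L (R ∘L R) ∘L p) = ∑' j, ‖p (R (b j))‖ₑ ^ 2 := by
  have hterm : ∀ i, ENNReal.ofReal (inner ℂ (w i) ((p ∘L (R ∘L R) ∘L p) (w i))).re
      = ∑' j, ‖inner ℂ (b j) (R (p (w i)))‖ₑ ^ 2 := fun i => by
    have hinner : inner ℂ (w i) ((p ∘L (R ∘L R) ∘L p) (w i))
        = inner ℂ (R (p (w i))) (R (p (w i))) := by
      rw [hR.isSymmetric.apply_clm, hp.isSymmetric.apply_clm]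
      rfl
    have hre : (inner ℂ (R (p (w i))) (R (p (w i)))).re = ‖R (p (w i))‖ ^ 2 :=
      inner_self_eq_norm_sq (𝕜 := ℂ) _
    rw [hinner, hre, ENNReal.ofReal_pow (norm_nonneg _), ofReal_norm, tsum_enorm_inner_sq]
  simp only [traceAlong, hterm]
  rw [ENNReal.tsum_comm]
  refine tsum_congr fun j => ?_
  rw [← tsum_enorm_inner_sq w]
  refine tsum_congr fun i => ?_
  rw [← hR.isSymmetric.apply_clm, ← hp.isSymmetric.apply_clm, ← inner_conj_symm, RCLike.enorm_conj]

end Hilbert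

section Restrict

variable {E : Type*} [MeasurableSpace E] {μ : Measure E} {A B : Set E}

theorem coeFn_restrictL (hA : MeasurableSet A) (f : Lp ℂ 2 μ) :
    restrictL μ hA f =ᵐ[μ] A.indicator f :=
  ((Lp.memLp f).indicator hA).coeFn_toLp

theorem inner_restrictL (hA : MeasurableSet A) (f g : Lp ℂ 2 μ) :
    inner ℂ f (restrictL μ hA g) = ∫ x in A, g x * conj (f x) ∂μ := by
  rw [L2.inner_def, ← integral_indicator hA]
  refine integral_congr_ae ?_
  filter_upwards [coeFn_restrictL hA g] with x hx
  rw [hx]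
  by_cases h : x ∈ A <;> simp [h]

theorem restrictL_restrictL (hA : MeasurableSet A) (hB : MeasurableSet B) (f : Lp ℂ 2 μ) :
    restrictL μ hA (restrictL μ hB f) = restrictL μ (hA.inter hB) f := by
  ext1
  filter_upwards [coeFn_restrictL hA (restrictL μ hB f), coeFn_restrictL hB f,
    coeFn_restrictL (hA.inter hB) f] with x h1 h2 h3
  rw [h1, h3, ← Set.indicator_indicator]
  by_cases h : x ∈ A <;> simp [h, h2]

theorem restrictL_restrictL_of_disjoint (hA : MeasurableSet A) (hB : MeasurableSet B)
    (hAB : Disjoint A B) (f : Lp ℂ 2 μ) : restrictL μ hA (restrictL μ hB f) = 0 := by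
  rw [restrictL_restrictL]
  ext1
  filter_upwards [coeFn_restrictL (hA.inter hB) f, Lp.coeFn_zero ℂ 2 μ] with x h1 h2
  rw [h1, h2, hAB.inter_eq, Set.indicator_empty, Pi.zero_apply]

theorem isStarProjection_restrictL (hA : MeasurableSet A) : IsStarProjection (restrictL μ hA) where
  isIdempotentElem := by
    ext1 f
    simpa only [Set.inter_self] using! restrictL_restrictL hA hA f
  isSelfAdjoint := by
    rw [ContinuousLinearMap.isSelfAdjoint_iff_isSymmetric]
    intro f g
    change inner ℂ (restrictL μ hA f) g = inner ℂ f (restrictL μ hA g)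
    rw [← inner_conj_symm, inner_restrictL, inner_restrictL, ← integral_conj]
    simp only [map_mul, Complex.conj_conj, mul_comm]

theorem eq_zero_of_forall_restrictL_eq_zero {ι : Type*} [Countable ι] {A : ι → Set E}
    (hAm : ∀ i, MeasurableSet (A i)) (hA : ⋃ i, A i = Set.univ) {f : Lp ℂ 2 μ}
    (h : ∀ i, restrictL μ (hAm i) f = 0) : f = 0 := by
  have hind : ∀ᵐ x ∂μ, ∀ i, (A i).indicator f x = 0 := by
    rw [ae_all_iff]
    intro i
    filter_upwards [coeFn_restrictL (hAm i) f, Lp.coeFn_zero ℂ 2 μ] with x h1 h2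
    rw [← h1, h i, h2, Pi.zero_apply]
  ext1
  filter_upwards [hind, Lp.coeFn_zero ℂ 2 μ] with x h1 h2
  obtain ⟨i, hi⟩ := Set.iUnion_eq_univ_iff.1 hA x
  rw [h2, Pi.zero_apply, ← h1 i, Set.indicator_of_mem hi]

theorem enorm_restrictL_sq (hA : MeasurableSet A) (f : Lp ℂ 2 μ) :
    ‖restrictL μ hA f‖ₑ ^ 2 = ∫⁻ x in A, ‖f x‖ₑ ^ 2 ∂μ := by
  have h : restrictL μ hA f = ((Lp.memLp f).indicator hA).toLp (A.indicator f) := rfl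
  rw [h, Lp.enorm_toLp, eLpNorm_indicator_eq_eLpNorm_restrict hA]
  simpa using eLpNorm_nnreal_pow_eq_lintegral (p := 2) two_ne_zero

theorem setLIntegral_tsum_enorm_sq {J : Type*} [Countable J] (hA : MeasurableSet A)
    (f : J → Lp ℂ 2 μ) :
    ∫⁻ x in A, ∑' j, ‖f j x‖ₑ ^ 2 ∂μ = ∑' j, ‖restrictL μ hA (f j)‖ₑ ^ 2 := by
  rw [lintegral_tsum fun j => ((Lp.stronglyMeasurable _).measurable.enorm.pow_const 2).aemeasurable]
  simp only [enorm_restrictL_sq]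

end Restrict

/-! ### Integral kernels of locally trace-class operators -/

theorem ae_eq_of_forall_setIntegral_prod_eq {X Y V : Type*} [MeasurableSpace X]
    [MeasurableSpace Y] [NormedAddCommGroup V] [NormedSpace ℝ V] [CompleteSpace V]
    {ν : Measure (X × Y)} {f g : X × Y → V} (hf : Integrable f ν) (hg : Integrable g ν)
    (h : ∀ s t, MeasurableSet s → MeasurableSet t → ∫ p in s ×ˢ t, f p ∂ν = ∫ p in s ×ˢ t, g p ∂ν) :
    f =ᵐ[ν] g := by
  have huniv : ∫ p, f p ∂ν = ∫ p, g p ∂ν := by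
    simpa using h Set.univ Set.univ MeasurableSet.univ MeasurableSet.univ
  suffices h_all : ∀ S, MeasurableSet S → ∫ p in S, f p ∂ν = ∫ p in S, g p ∂ν from
    Integrable.ae_eq_of_forall_setIntegral_eq f g hf hg fun S hS _ => h_all S hS
  intro S hS
  induction S, hS using
    MeasurableSpace.induction_on_inter generateFrom_prod.symm isPiSystem_prod with
  | empty => simp
  | basic u hu =>
    obtain ⟨s, hs, t, ht, rfl⟩ := hu
    exact h s t hs ht
  | compl u hu ih =>
    rw [← integral_add_compl hu hf, ← integral_add_compl hu hg, ih] at huniv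
    exact add_left_cancel huniv
  | iUnion u hd hu ih =>
    rw [integral_iUnion hu hd hf.integrableOn, integral_iUnion hu hd hg.integrableOn]
    exact tsum_congr ih

theorem measure_ext_of_isCompact {E : Type*} [TopologicalSpace E] [T2Space E] [SigmaCompactSpace E]
    [MeasurableSpace E] [BorelSpace E] {μ ν : Measure E} [IsFiniteMeasureOnCompacts μ]
    (h : ∀ C, IsCompact C → μ C = ν C) : μ = ν := by
  have hC := isCompact_compactCovering E
  have hclosed : ∀ s, IsClosed s → μ s = ν s := fun s hs => by
    have hmono : Monotone fun n => s ∩ compactCovering E n := fun _ _ hmn =>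
      Set.inter_subset_inter_right s (compactCovering_subset E hmn)
    rw [← Set.inter_univ s, ← iUnion_compactCovering E, Set.inter_iUnion, hmono.measure_iUnion,
      hmono.measure_iUnion]
    exact iSup_congr fun n => h _ ((hC n).inter_left hs)
  exact Measure.ext_of_generateFrom_of_iUnion {s | IsClosed s} (compactCovering E)
    (by rw [BorelSpace.measurable_eq (α := E), borel_eq_generateFrom_isClosed]) isPiSystem_isClosed
    (iUnion_compactCovering E) (fun n => (hC n).isClosed) (fun n => (hC n).measure_ne_top) hclosed

theorem ae_eq_of_forall_isCompact_setLIntegral_eq {E : Type*} [TopologicalSpace E] [T2Space E]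
    [SigmaCompactSpace E] [MeasurableSpace E] [BorelSpace E] {μ : Measure E} [SigmaFinite μ]
    {f g : E → ℝ≥0∞} (hf : Measurable f) (hg : Measurable g)
    (hfin : ∀ C, IsCompact C → ∫⁻ x in C, f x ∂μ ≠ ∞)
    (h : ∀ C, IsCompact C → ∫⁻ x in C, f x ∂μ = ∫⁻ x in C, g x ∂μ) : f =ᵐ[μ] g := by
  have : IsFiniteMeasureOnCompacts (μ.withDensity f) :=
    ⟨fun C hC => by simpa only [withDensity_apply f hC.measurableSet] using (hfin C hC).lt_top⟩
  rw [← withDensity_eq_iff_of_sigmaFinite hf.aemeasurable hg.aemeasurable]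
  refine measure_ext_of_isCompact fun C hC => ?_
  rw [withDensity_apply _ hC.measurableSet, withDensity_apply _ hC.measurableSet, h C hC]

section TsumMulConj

variable {E J : Type*} {v : J → E → ℂ}

theorem tsum_enorm_mul_conj_le (v : J → E → ℂ) (x y : E) :
    ∑' j, ‖v j x * conj (v j y)‖ₑ ≤ ∑' j, ‖v j x‖ₑ ^ 2 + ∑' j, ‖v j y‖ₑ ^ 2 := by
  rw [← ENNReal.tsum_add]
  refine ENNReal.tsum_le_tsum fun j => ?_
  rw [enorm_mul, RCLike.enorm_conj, sq, sq]
  rcases le_total ‖v j x‖ₑ ‖v j y‖ₑ with h | h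
  · exact (mul_le_mul_left h _).trans le_add_self
  · exact (mul_le_mul_right h _).trans le_self_add

theorem hasSum_mul_conj_of_tsum_enorm_sq_eq {a : J → ℂ} {z : ℂ} (hz : 0 ≤ z)
    (h : ∑' j, ‖a j‖ₑ ^ 2 = ENNReal.ofReal z.re) : HasSum (fun j => a j * conj (a j)) z := by
  have hne : ∑' j, ‖a j‖ₑ ^ 2 ≠ ∞ := h ▸ ENNReal.ofReal_ne_top
  have hre : HasSum (fun j => ‖a j‖ ^ 2) z.re := by
    have hsum := (ENNReal.summable_toReal hne).hasSum
    rw [← ENNReal.tsum_toReal_eq (ENNReal.ne_top_of_tsum_ne_top hne), h,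
      ENNReal.toReal_ofReal (Complex.le_def.1 hz).1] at hsum
    simpa using hsum
  rw [Complex.eq_re_of_ofReal_le hz]
  simpa [Complex.mul_conj'] using Complex.hasSum_ofReal.2 hre

variable [MeasurableSpace E]

theorem measurable_mul_conj (hv : ∀ j, Measurable (v j)) (j : J) :
    Measurable fun p : E × E => v j p.1 * conj (v j p.2) :=
  ((hv j).comp measurable_fst).mul
    (Complex.continuous_conj.measurable.comp ((hv j).comp measurable_snd))

variable [Countable J] {ν ν' : Measure E} [IsFiniteMeasure ν] [IsFiniteMeasure ν']

theorem lintegral_prod_tsum_enorm_mul_conj_ne_top (hv : ∀ j, Measurable (v j))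
    (hfin : ∫⁻ x, ∑' j, ‖v j x‖ₑ ^ 2 ∂ν ≠ ∞) (hfin' : ∫⁻ x, ∑' j, ‖v j x‖ₑ ^ 2 ∂ν' ≠ ∞) :
    ∫⁻ p, ∑' j, ‖v j p.1 * conj (v j p.2)‖ₑ ∂(ν.prod ν') ≠ ∞ := by
  have hV : Measurable fun x => ∑' j, ‖v j x‖ₑ ^ 2 :=
    Measurable.tsum fun j => (hv j).enorm.pow_const 2
  refine ne_top_of_le_ne_top ?_ (lintegral_mono fun p => tsum_enorm_mul_conj_le v p.1 p.2)
  have hfst := lintegral_prod_mul (μ := ν) (ν := ν') hV.aemeasurable (aemeasurable_const (b := 1))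
  have hsnd := lintegral_prod_mul (μ := ν) (ν := ν') (aemeasurable_const (b := 1)) hV.aemeasurable
  simp only [mul_one, one_mul, lintegral_const] at hfst hsnd
  have hVfst : Measurable fun p : E × E => ∑' j, ‖v j p.1‖ₑ ^ 2 := hV.comp measurable_fst
  rw [lintegral_add_left hVfst, hfst, hsnd]
  finiteness

theorem ae_hasSum_mul_conj (hv : ∀ j, Measurable (v j))
    (hfin : ∫⁻ x, ∑' j, ‖v j x‖ₑ ^ 2 ∂ν ≠ ∞) (hfin' : ∫⁻ x, ∑' j, ‖v j x‖ₑ ^ 2 ∂ν' ≠ ∞) :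
    ∀ᵐ p ∂ν.prod ν', HasSum (fun j => v j p.1 * conj (v j p.2))
      (∑' j, v j p.1 * conj (v j p.2)) := by
  filter_upwards [ae_lt_top (Measurable.tsum fun j => (measurable_mul_conj hv j).enorm)
    (lintegral_prod_tsum_enorm_mul_conj_ne_top hv hfin hfin')] with p hp
  exact (Summable.of_norm (by simpa using ENNReal.summable_toReal hp.ne)).hasSum

theorem integrable_tsum_mul_conj (hv : ∀ j, Measurable (v j))
    (hfin : ∫⁻ x, ∑' j, ‖v j x‖ₑ ^ 2 ∂ν ≠ ∞) (hfin' : ∫⁻ x, ∑' j, ‖v j x‖ₑ ^ 2 ∂ν' ≠ ∞) :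
    Integrable (fun p : E × E => ∑' j, v j p.1 * conj (v j p.2)) (ν.prod ν') :=
  ⟨(Measurable.tsum (measurable_mul_conj hv)).aestronglyMeasurable,
    (lintegral_mono fun _ => enorm_tsum_le_tsum_enorm).trans_lt
      (lintegral_prod_tsum_enorm_mul_conj_ne_top hv hfin hfin').lt_top⟩

theorem integral_prod_tsum_mul_conj (hv : ∀ j, Measurable (v j))
    (hfin : ∫⁻ x, ∑' j, ‖v j x‖ₑ ^ 2 ∂ν ≠ ∞) (hfin' : ∫⁻ x, ∑' j, ‖v j x‖ₑ ^ 2 ∂ν' ≠ ∞) :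
    ∫ p, ∑' j, v j p.1 * conj (v j p.2) ∂ν.prod ν'
      = ∑' j, (∫ x, v j x ∂ν) * conj (∫ y, v j y ∂ν') := by
  have hne := lintegral_prod_tsum_enorm_mul_conj_ne_top hv hfin hfin'
  rw [integral_tsum (fun j => (measurable_mul_conj hv j).aestronglyMeasurable)
    (by rwa [← lintegral_tsum fun j => (measurable_mul_conj hv j).enorm.aemeasurable])]
  refine tsum_congr fun j => ?_
  rw [integral_prod_mul (fun x => v j x) fun y => conj (v j y), integral_conj]

end TsumMulConj

section Kernel

variable {E : Type*} [MeasurableSpace E] {μ : Measure E} {K R : Lp ℂ 2 μ →L[ℂ] Lp ℂ 2 μ}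
  {k : E → E → ℂ} {J : Type*} [Countable J]

theorem measurable_coeFn_Lp (f : Lp ℂ 2 μ) : Measurable f :=
  (Lp.stronglyMeasurable f).measurable

theorem setLIntegral_tsum_eq_traceAlong {I : Type*} (hR : IsSelfAdjoint R) (hRK : R ∘L R = K)
    (b : HilbertBasis J ℂ (Lp ℂ 2 μ)) (w : HilbertBasis I ℂ (Lp ℂ 2 μ)) {A : Set E}
    (hA : MeasurableSet A) :
    ∫⁻ x in A, ∑' j, ‖R (b j) x‖ₑ ^ 2 ∂μ = traceAlong w (compression μ K hA) := by
  rw [setLIntegral_tsum_enorm_sq hA, compression, ← hRK,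
    traceAlong_compress hR (isStarProjection_restrictL hA).isSelfAdjoint w b]

theorem integral_prod_tsum_eq_inner (hR : IsSelfAdjoint R) (hRK : R ∘L R = K)
    (b : HilbertBasis J ℂ (Lp ℂ 2 μ)) {s t : Set E} (hs : MeasurableSet s) (ht : MeasurableSet t)
    (hμs : μ s ≠ ∞) (hμt : μ t ≠ ∞) (hfins : ∫⁻ x in s, ∑' j, ‖R (b j) x‖ₑ ^ 2 ∂μ ≠ ∞)
    (hfint : ∫⁻ x in t, ∑' j, ‖R (b j) x‖ₑ ^ 2 ∂μ ≠ ∞) :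
    ∫ p, ∑' j, R (b j) p.1 * conj (R (b j) p.2) ∂(μ.restrict s).prod (μ.restrict t)
      = inner ℂ (indicatorConstLp 2 hs hμs (1 : ℂ)) (K (indicatorConstLp 2 ht hμt 1)) := by
  have : IsFiniteMeasure (μ.restrict s) := ⟨by rwa [Measure.restrict_apply_univ, lt_top_iff_ne_top]⟩
  have : IsFiniteMeasure (μ.restrict t) := ⟨by rwa [Measure.restrict_apply_univ, lt_top_iff_ne_top]⟩
  rw [integral_prod_tsum_mul_conj (fun j => measurable_coeFn_Lp _) hfins hfint, ← hRK]
  refine Eq.trans ?_ (hasSum_inner_mul_conj_inner b hR _ _).tsum_eq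
  simp only [L2.inner_indicatorConstLp_one]

variable [TopologicalSpace E]

namespace IsKernel

theorem integrable_restrict [IsFiniteMeasureOnCompacts μ] [SFinite μ] (hk : IsKernel μ K k)
    {C : Set E} (hC : IsCompact C) :
    Integrable (fun p : E × E => k p.1 p.2) ((μ.restrict C).prod (μ.restrict C)) := by
  have : IsFiniteMeasure (μ.restrict C) :=
    ⟨by rw [Measure.restrict_apply_univ]; exact hC.measure_lt_top⟩
  have hsq := hk.sq_integrable C hC
  rw [IntegrableOn, ← Measure.prod_restrict] at hsq
  exact ((memLp_two_iff_integrable_sq_norm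
    (f := fun p : E × E => k p.1 p.2) hk.measurable.aestronglyMeasurable).2 hsq).integrable
      one_le_two

theorem integral_prod_eq_inner [SFinite μ] (hk : IsKernel μ K k) {C s t : Set E} (hC : IsCompact C)
    (hs : MeasurableSet s) (ht : MeasurableSet t) (htC : t ⊆ C) (hμs : μ s ≠ ∞) (hμt : μ t ≠ ∞)
    (hint : Integrable (fun p : E × E => k p.1 p.2) ((μ.restrict s).prod (μ.restrict t))) :
    ∫ p, k p.1 p.2 ∂(μ.restrict s).prod (μ.restrict t)
      = inner ℂ (indicatorConstLp 2 hs hμs (1 : ℂ)) (K (indicatorConstLp 2 ht hμt 1)) := by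
  have hind : (indicatorConstLp 2 ht hμt (1 : ℂ) : E → ℂ) =ᵐ[μ] t.indicator fun _ => 1 :=
    indicatorConstLp_coeFn
  have hzero : ∀ᵐ x ∂μ, x ∉ C → (indicatorConstLp 2 ht hμt (1 : ℂ) : E → ℂ) x = 0 := by
    filter_upwards [hind] with x hx hxC
    rw [hx, Set.indicator_of_notMem fun h => hxC (htC h)]
  rw [integral_prod _ hint, L2.inner_indicatorConstLp_one]
  refine integral_congr_ae (ae_restrict_of_ae ?_)
  filter_upwards [hk.apply_eq C hC _ hzero] with x hx
  rw [hx, ← integral_indicator ht]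
  refine integral_congr_ae ?_
  filter_upwards [hind] with y hy
  rw [hy]
  by_cases h : y ∈ t <;> simp [h]

variable [T2Space E] [BorelSpace E]

theorem ae_hasSum_diagonal [SigmaCompactSpace E] [SigmaFinite μ] (hk : IsKernel μ K k)
    (hR : IsSelfAdjoint R) (hRK : R ∘L R = K) (b : HilbertBasis J ℂ (Lp ℂ 2 μ))
    (hfin : ∀ C, IsCompact C → ∫⁻ x in C, ∑' j, ‖R (b j) x‖ₑ ^ 2 ∂μ ≠ ∞) :
    ∀ᵐ x ∂μ, HasSum (fun j => R (b j) x * conj (R (b j) x)) (k x x) := by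
  have hV : Measurable fun x => ∑' j, ‖R (b j) x‖ₑ ^ 2 :=
    Measurable.tsum fun j => (measurable_coeFn_Lp _).enorm.pow_const 2
  have hkd : Measurable fun x => ENNReal.ofReal (k x x).re :=
    ENNReal.measurable_ofReal.comp (Complex.measurable_re.comp
      (hk.measurable.comp (measurable_id.prodMk measurable_id)))
  obtain ⟨w, b', -⟩ := exists_hilbertBasis ℂ (Lp ℂ 2 μ)
  filter_upwards [ae_eq_of_forall_isCompact_setLIntegral_eq hV hkd hfin fun C hC => by
    rw [hk.diagonal C hC.measurableSet hC w b', setLIntegral_tsum_eq_traceAlong hR hRK b b']]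
    with x hx
  exact hasSum_mul_conj_of_tsum_enorm_sq_eq ((hk.posSemidef 1 fun _ => x).diag_nonneg (i := 0)) hx

variable [IsFiniteMeasureOnCompacts μ]

theorem ae_hasSum_restrict [SFinite μ] (hk : IsKernel μ K k) (hR : IsSelfAdjoint R)
    (hRK : R ∘L R = K) (b : HilbertBasis J ℂ (Lp ℂ 2 μ)) {C : Set E} (hC : IsCompact C)
    (hfin : ∫⁻ x in C, ∑' j, ‖R (b j) x‖ₑ ^ 2 ∂μ ≠ ∞) :
    ∀ᵐ p ∂(μ.restrict C).prod (μ.restrict C),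
      HasSum (fun j => R (b j) p.1 * conj (R (b j) p.2)) (k p.1 p.2) := by
  have : IsFiniteMeasure (μ.restrict C) :=
    ⟨by rw [Measure.restrict_apply_univ]; exact hC.measure_lt_top⟩
  have hv : ∀ j, Measurable (R (b j)) := fun j => measurable_coeFn_Lp _
  have hint := hk.integrable_restrict hC
  have hμ : ∀ s, μ (s ∩ C) ≠ ∞ := fun s =>
    measure_ne_top_of_subset Set.inter_subset_right hC.measure_lt_top.ne
  have hfin_inter : ∀ s, ∫⁻ x in s ∩ C, ∑' j, ‖R (b j) x‖ₑ ^ 2 ∂μ ≠ ∞ := fun s =>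
    ne_top_of_le_ne_top hfin (lintegral_mono_set Set.inter_subset_right)
  have hae : (fun p : E × E => k p.1 p.2) =ᵐ[(μ.restrict C).prod (μ.restrict C)]
      fun p => ∑' j, R (b j) p.1 * conj (R (b j) p.2) := by
    refine ae_eq_of_forall_setIntegral_prod_eq hint (integrable_tsum_mul_conj hv hfin hfin)
      fun s t hs ht => ?_
    have hint_inter := hint.integrableOn (s := s ×ˢ t)
    rw [IntegrableOn, ← Measure.prod_restrict, Measure.restrict_restrict hs,
      Measure.restrict_restrict ht] at hint_inter
    have hsC := hs.inter hC.measurableSet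
    have htC := ht.inter hC.measurableSet
    rw [← Measure.prod_restrict, Measure.restrict_restrict hs, Measure.restrict_restrict ht,
      hk.integral_prod_eq_inner hC hsC htC Set.inter_subset_right (hμ s) (hμ t) hint_inter,
      integral_prod_tsum_eq_inner hR hRK b hsC htC (hμ s) (hμ t) (hfin_inter s) (hfin_inter t)]
  filter_upwards [ae_hasSum_mul_conj hv hfin hfin, hae] with p hsum hp
  rwa [hp]

theorem isGram [SigmaCompactSpace E] [SigmaFinite μ] (hk : IsKernel μ K k)
    (hR : IsSelfAdjoint R) (hRK : R ∘L R = K) (b : HilbertBasis J ℂ (Lp ℂ 2 μ))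
    (hfin : ∀ C, IsCompact C → ∫⁻ x in C, ∑' j, ‖R (b j) x‖ₑ ^ 2 ∂μ ≠ ∞) :
    IsGram μ k fun j => (R (b j) : E → ℂ) where
  measurable := fun j => measurable_coeFn_Lp _
  off_diagonal := by
    have hcover : ⋃ n, compactCovering E n ×ˢ compactCovering E n = (Set.univ : Set (E × E)) := by
      have hmono := compactCovering_subset E
      rw [Set.iUnion_prod_of_monotone hmono hmono, iUnion_compactCovering, Set.univ_prod_univ]
    rw [← Measure.restrict_univ (μ := μ.prod μ), ← hcover, ae_restrict_iUnion_iff]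
    intro n
    have hC := isCompact_compactCovering E n
    rw [← Measure.prod_restrict]
    exact hk.ae_hasSum_restrict hR hRK b hC (hfin _ hC)
  diagonal := hk.ae_hasSum_diagonal hR hRK b hfin

end IsKernel

end Kernel

/-! ### Hilbert bases adapted to a partition -/

section AdaptedBasis

variable {H ι : Type*} [NormedAddCommGroup H] [InnerProductSpace ℂ H] [CompleteSpace H]

theorem exists_hilbertBasis_sigma {V : ι → Submodule ℂ H}
    [∀ i, CompleteSpace (V i)] (hV : OrthogonalFamily ℂ (fun i => V i) fun i => (V i).subtypeₗᵢ)
    (htot : (⨆ i, V i)ᗮ = ⊥) :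
    ∃ (w : ∀ i, Set (V i)) (b : HilbertBasis (Σ i, w i) ℂ H), ∀ y, b y ∈ V y.1 := by
  choose w u _ using fun i => exists_hilbertBasis ℂ (V i)
  let v : (Σ i, w i) → H := fun y => u y.1 y.2
  have hv : Orthonormal ℂ v := hV.orthonormal_sigma_orthonormal fun i => (u i).orthonormal
  have hvtot : (Submodule.span ℂ (Set.range v))ᗮ = ⊥ := by
    refine eq_bot_iff.2 fun f hf => htot ▸ ?_
    rw [← Submodule.iInf_orthogonal, Submodule.mem_iInf]
    intro i
    refine (Submodule.mem_orthogonal' _ _).2 fun g hg => ?_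
    have hsum := ((u i).hasSum_repr ⟨g, hg⟩).mapL (innerSL ℂ f ∘L (V i).subtypeL)
    have hperp : ∀ y, inner ℂ f (u i y : H) = 0 := fun y =>
      (Submodule.mem_orthogonal' _ _).1 hf _ (Submodule.subset_span ⟨⟨i, y⟩, rfl⟩)
    refine hsum.unique ?_
    simp [hperp]
  refine ⟨w, HilbertBasis.mkOfOrthogonalEqBot hv hvtot, fun y => ?_⟩
  rw [HilbertBasis.coe_mkOfOrthogonalEqBot]
  exact (u y.1 y.2).2

theorem exists_reindex_hilbertBasis [TopologicalSpace.SeparableSpace H] {J : Type*}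
    (b : HilbertBasis J ℂ H) :
    ∃ (F : Type) (_ : Countable F) (e : F ≃ J) (b' : HilbertBasis F ℂ H), ∀ y, b' y = b (e y) := by
  have := countable_of_orthonormal b.orthonormal
  let e := (equivShrink.{0} J).symm
  have hspan : ⊤ ≤ (Submodule.span ℂ (Set.range (b ∘ e))).topologicalClosure := by
    rw [e.surjective.range_comp]
    exact b.dense_span.ge
  refine ⟨Shrink.{0} J, e.injective.countable, e,
    HilbertBasis.mk (b.orthonormal.comp e e.injective) hspan, fun y => ?_⟩
  rw [HilbertBasis.coe_mk, Function.comp_apply]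

theorem exists_hilbertBasis_forall_apply_eq_indicator [TopologicalSpace.SeparableSpace H]
    {p : ι → H →L[ℂ] H} (hp : ∀ i, IsStarProjection (p i))
    (hdisj : Pairwise fun i j => ∀ f, p i (p j f) = 0) (htot : ∀ f, (∀ i, p i f = 0) → f = 0) :
    ∃ (F : Type) (_ : Countable F) (b : HilbertBasis F ℂ H) (κ : F → ι),
      ∀ i y, p i (b y) = (κ ⁻¹' {i}).indicator b y := by
  have hmem : ∀ i f, f ∈ (p i).range ↔ p i f = f := fun i f =>
    LinearMap.IsIdempotentElem.mem_range_iff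
      (ContinuousLinearMap.IsIdempotentElem.toLinearMap (hp i).isIdempotentElem)
  have : ∀ i, CompleteSpace (p i).range := fun i =>
    (ContinuousLinearMap.IsIdempotentElem.isClosed_range (hp i).isIdempotentElem).completeSpace_coe
  have hV : OrthogonalFamily ℂ (fun i => (p i).range) fun i => (p i).range.subtypeₗᵢ := by
    rintro i j hij ⟨_, f, rfl⟩ ⟨_, g, rfl⟩
    change inner ℂ (p i f) (p j g) = 0
    rw [(hp i).isSelfAdjoint.isSymmetric.apply_clm, hdisj hij, inner_zero_right]
  have hVtot : (⨆ i, (p i).range)ᗮ = ⊥ := by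
    refine eq_bot_iff.2 fun f hf => htot f fun i => ?_
    rw [← Submodule.iInf_orthogonal, Submodule.mem_iInf] at hf
    have hfi := hf i
    rwa [ContinuousLinearMap.orthogonal_range, (hp i).isSelfAdjoint.adjoint_eq] at hfi
  obtain ⟨w, b, hb⟩ := exists_hilbertBasis_sigma hV hVtot
  obtain ⟨F, hF, e, b', hb'⟩ := exists_reindex_hilbertBasis b
  refine ⟨F, hF, b', fun y => (e y).1, fun i y => ?_⟩
  have hby : p (e y).1 (b' y) = b' y := hb' y ▸ (hmem _ _).1 (hb (e y))
  by_cases hy : (e y).1 = i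
  · subst hy
    simpa using hby
  · rw [← hby, hdisj (Ne.symm hy), Set.indicator_of_notMem (s := (fun y => (e y).1) ⁻¹' {i}) hy]

end AdaptedBasis

/-! ### The matrix of an operator in a Hilbert basis -/

section Matrix

variable {H F : Type*} [NormedAddCommGroup H] [InnerProductSpace ℂ H] {K : H →L[ℂ] H}

theorem posSemidef_inner_apply {I : Type*} (hK : K.IsPositive) (u : I → H) :
    (Matrix.of fun i j => inner ℂ (u i) (K (u j))).PosSemidef := by
  refine ⟨Matrix.IsHermitian.ext fun i j => ?_, fun c => ?_⟩
  · rw [RCLike.star_def, Matrix.of_apply, inner_conj_symm]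
    exact hK.isSymmetric _ _
  · have h := hK.inner_nonneg_right (c.sum fun i z => z • u i)
    simp only [Finsupp.sum, map_sum, map_smul, inner_sum, sum_inner, inner_smul_left,
      inner_smul_right, Finset.mul_sum] at h
    rw [Finset.sum_comm] at h
    refine h.trans_eq (Finset.sum_congr rfl fun i _ => Finset.sum_congr rfl fun j _ => ?_)
    simp only [RCLike.star_def, Matrix.of_apply]
    ring

variable [CompleteSpace H]

theorem matrixEntry_conjStarAlgEquiv (b : HilbertBasis F ℂ H) (K : H →L[ℂ] H) (x y : F) :
    matrixEntry (b.repr.conjStarAlgEquiv K) x y = inner ℂ (b x) (K (b y)) := by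
  classical
  rw [matrixEntry, LinearIsometryEquiv.conjStarAlgEquiv_apply_apply,
    HilbertBasis.repr_apply_apply]
  congr 3

namespace IsPositiveContraction

theorem isPositive_one_sub (hK : IsPositiveContraction K) : (1 - K).IsPositive := by
  rw [← ContinuousLinearMap.nonneg_iff_isPositive, sub_nonneg]
  have h0 := (ContinuousLinearMap.nonneg_iff_isPositive K).2 hK.1
  exact (CStarAlgebra.norm_le_one_iff_of_nonneg K h0).1 hK.2

theorem conjStarAlgEquiv {H' : Type*} [NormedAddCommGroup H'] [InnerProductSpace ℂ H']
    [CompleteSpace H'] (hK : IsPositiveContraction K) (e : H ≃ₗᵢ[ℂ] H') :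
    IsPositiveContraction (e.conjStarAlgEquiv K) := by
  refine ⟨?_, (StarAlgEquiv.norm_map e.conjStarAlgEquiv K).trans_le hK.2⟩
  rw [← ContinuousLinearMap.nonneg_iff_isPositive]
  exact map_nonneg e.conjStarAlgEquiv ((ContinuousLinearMap.nonneg_iff_isPositive K).2 hK.1)

theorem exists_isDiscreteDeterminantalLaw [Countable F] [TopologicalSpace F]
    [DiscreteTopology F] [MeasurableSpace F] [BorelSpace F] (hK : IsPositiveContraction K)
    (b : HilbertBasis F ℂ H) :
    ∃ P : Measure (Config F), IsDiscreteDeterminantalLaw (b.repr.conjStarAlgEquiv K) P := by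
  classical
  have hQ : matrixEntry (b.repr.conjStarAlgEquiv K)
      = Matrix.of fun x y => inner ℂ (b x) (K (b y)) :=
    funext₂ (matrixEntry_conjStarAlgEquiv b K)
  unfold IsDiscreteDeterminantalLaw
  rw [hQ]
  have hQ' : 1 - Matrix.of (fun x y => inner ℂ (b x) (K (b y)))
      = Matrix.of fun x y => inner ℂ (b x) ((1 - K) (b y)) := by
    ext x y
    simp [Matrix.one_apply, orthonormal_iff_ite.1 b.orthonormal x y]
  exact exists_isDeterminantalWith_count (posSemidef_inner_apply hK.1 b)
    (hQ' ▸ posSemidef_inner_apply hK.isPositive_one_sub b)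

end IsPositiveContraction

theorem inner_apply_eq_indicator {b : HilbertBasis F ℂ H} {p : H →L[ℂ] H} {B : Set F}
    (hp : IsSelfAdjoint p) (hpb : ∀ y, p (b y) = B.indicator b y) (f : H) (y : F) :
    inner ℂ (b y) (p f) = B.indicator (fun y => inner ℂ (b y) f) y := by
  classical
  rw [← hp.isSymmetric.apply_clm, hpb, Set.indicator_apply, Set.indicator_apply]
  split_ifs <;> simp

variable [Countable F] [MeasurableSpace F] [MeasurableSingletonClass F]

theorem isGram_count_matrixEntry (b : HilbertBasis F ℂ H) {R : H →L[ℂ] H} (hR : IsSelfAdjoint R)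
    (hRK : R ∘L R = K) :
    IsGram Measure.count (matrixEntry (b.repr.conjStarAlgEquiv K))
      fun j y => inner ℂ (b y) (R (b j)) := by
  have h : ∀ x y, HasSum (fun j => inner ℂ (b x) (R (b j)) * conj (inner ℂ (b y) (R (b j))))
      (matrixEntry (b.repr.conjStarAlgEquiv K) x y) := fun x y => by
    rw [matrixEntry_conjStarAlgEquiv, ← hRK]
    exact hasSum_inner_mul_conj_inner b hR (b x) (b y)
  exact ⟨fun j => measurable_of_countable _, Eventually.of_forall fun p => h _ _,
    Eventually.of_forall fun x => h _ _⟩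

variable {b : HilbertBasis F ℂ H} {p : H →L[ℂ] H} {B : Set F}

theorem setLIntegral_count_enorm_inner_sq (hp : IsSelfAdjoint p)
    (hpb : ∀ y, p (b y) = B.indicator b y) (f : H) :
    ∫⁻ y in B, ‖inner ℂ (b y) f‖ₑ ^ 2 ∂Measure.count = ‖p f‖ₑ ^ 2 := by
  classical
  rw [← lintegral_indicator B.to_countable.measurableSet, lintegral_count,
    ← tsum_enorm_inner_sq b]
  refine tsum_congr fun y => ?_
  rw [inner_apply_eq_indicator hp hpb, Set.indicator_apply, Set.indicator_apply]
  split_ifs <;> simp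

theorem setIntegral_count_inner_mul_conj_inner (hp : IsSelfAdjoint p)
    (hpb : ∀ y, p (b y) = B.indicator b y) (f g : H) :
    ∫ y in B, inner ℂ (b y) f * conj (inner ℂ (b y) g) ∂Measure.count = inner ℂ g (p f) := by
  have h := b.hasSum_inner_mul_inner g (p f)
  have heq : B.indicator (fun y => inner ℂ (b y) f * conj (inner ℂ (b y) g))
      = fun y => inner ℂ g (b y) * inner ℂ (b y) (p f) := by
    classical
    ext y
    rw [inner_apply_eq_indicator hp hpb, Set.indicator_apply, Set.indicator_apply,
      inner_conj_symm]
    split_ifs <;> simp [mul_comm]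
  rw [← integral_indicator B.to_countable.measurableSet, heq,
    integral_countable (integrable_count_iff.2 h.summable.norm), ← h.tsum_eq]
  simp

end Matrix

section Comparison

variable {E : Type*} [TopologicalSpace E] [SecondCountableTopology E]
  [TopologicalSpace.MetrizableSpace E] [LocallyCompactSpace E] [MeasurableSpace E] [BorelSpace E]
  {μ : Measure E} [IsFiniteMeasureOnCompacts μ] {K : Lp ℂ 2 μ →L[ℂ] Lp ℂ 2 μ}
  {F : Type*} [Countable F] [TopologicalSpace F] [DiscreteTopology F] [MeasurableSpace F]
  [BorelSpace F]

theorem jointCountLaw_eq_of_adapted_hilbertBasis (hK : K.IsPositive)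
    (hK' : IsLocallyTraceClass μ K) {A : ℕ → Set E} (hA : Pairwise fun i j => Disjoint (A i) (A j))
    (hAm : ∀ i, MeasurableSet (A i)) (hAc : ∀ i, IsCompact (closure (A i)))
    {b : HilbertBasis F ℂ (Lp ℂ 2 μ)} {B : ℕ → Set F}
    (hB : Pairwise fun i j => Disjoint (B i) (B j))
    (hb : ∀ i y, restrictL μ (hAm i) (b y) = (B i).indicator b y)
    {P : Measure (Config E)} {P' : Measure (Config F)} (hP : IsDeterminantalLaw μ K P)
    (hP' : IsDiscreteDeterminantalLaw (b.repr.conjStarAlgEquiv K) P') :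
    jointCountLaw P A = jointCountLaw P' B := by
  obtain ⟨k, hk, hkP⟩ := hP
  obtain ⟨R, hR, hRK⟩ := exists_isSelfAdjoint_comp_self_eq hK
  obtain ⟨w, b', -⟩ := exists_hilbertBasis ℂ (Lp ℂ 2 μ)
  have hp : ∀ i, IsSelfAdjoint (restrictL μ (hAm i)) := fun i =>
    (isStarProjection_restrictL (hAm i)).isSelfAdjoint
  have hfin_compact : ∀ C, IsCompact C → ∫⁻ x in C, ∑' j, ‖R (b j) x‖ₑ ^ 2 ∂μ ≠ ∞ := fun C hC => by
    rw [setLIntegral_tsum_eq_traceAlong hR hRK b b' hC.measurableSet]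
    exact (hK' C hC.measurableSet hC).2 w b'
  have hfin : ∀ i, ∫⁻ x in A i, ∑' j, ‖R (b j) x‖ₑ ^ 2 ∂μ ≠ ∞ := fun i =>
    ne_top_of_le_ne_top (hfin_compact _ (hAc i)) (lintegral_mono_set subset_closure)
  have hfin' : ∀ i, ∫⁻ y in B i, ∑' j, ‖inner ℂ (b y) (R (b j))‖ₑ ^ 2 ∂Measure.count ≠ ∞ :=
    fun i => by
      rw [lintegral_tsum fun j => (measurable_of_countable _).aemeasurable]
      simp_rw [setLIntegral_count_enorm_inner_sq (hp i) (hb i)]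
      rw [← setLIntegral_tsum_enorm_sq]
      exact hfin i
  refine jointCountLaw_eq_of_isGram hkP hP' (hk.isGram hR hRK b hfin_compact)
    (isGram_count_matrixEntry b hR hRK) hA hB hAm (fun i => (B i).to_countable.measurableSet)
    hfin hfin' fun i j l => ?_
  rw [setIntegral_count_inner_mul_conj_inner (hp i) (hb i), inner_restrictL]

end Comparison

end DPP

theorem theorem1 {E : Type*} [TopologicalSpace E] [PolishSpace E] [LocallyCompactSpace E]
    [MeasurableSpace E] [BorelSpace E]
    (μ : Measure E) [IsFiniteMeasureOnCompacts μ]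
    (K : Lp ℂ 2 μ →L[ℂ] Lp ℂ 2 μ)
    (hK : DPP.IsPositiveContraction K) (hK' : DPP.IsLocallyTraceClass μ K)
    (A : ℕ → Set E) (hA : DPP.IsPartition A)
    (hA_meas : ∀ i, MeasurableSet (A i)) (hA_compact : ∀ i, IsCompact (closure (A i))) :
    ∃ (F : Type) (_ : Countable F) (_ : TopologicalSpace F) (_ : DiscreteTopology F)
      (_ : MeasurableSpace F) (_ : BorelSpace F)
      (B : ℕ → Set F) (Q : DPP.Ell2 F →L[ℂ] DPP.Ell2 F),
      DPP.IsPartition B ∧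
      DPP.IsPositiveContraction Q ∧
      (∃ U : Lp ℂ 2 μ ≃ₗᵢ[ℂ] DPP.Ell2 F, ∀ f, U (K f) = Q (U f)) ∧
      (∃ P' : Measure (DPP.Config F), DPP.IsDiscreteDeterminantalLaw Q P') ∧
      ∀ (P : Measure (DPP.Config E)) (P' : Measure (DPP.Config F)),
        DPP.IsDeterminantalLaw μ K P → DPP.IsDiscreteDeterminantalLaw Q P' →
          DPP.jointCountLaw P A = DPP.jointCountLaw P' B := by
  have : Fact ((2 : ℝ≥0∞) ≠ ∞) := ⟨ENNReal.ofNat_ne_top⟩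
  obtain ⟨F, hF, b, κ, hb⟩ := DPP.exists_hilbertBasis_forall_apply_eq_indicator
    (fun i => DPP.isStarProjection_restrictL (μ := μ) (hA_meas i))
    (fun i j hij f => DPP.restrictL_restrictL_of_disjoint (hA_meas i) (hA_meas j) (hA.1 hij) f)
    fun f hf => DPP.eq_zero_of_forall_restrictL_eq_zero hA_meas hA.2 hf
  let : TopologicalSpace F := ⊥
  have : DiscreteTopology F := ⟨rfl⟩
  let : MeasurableSpace F := borel F
  have : BorelSpace F := ⟨rfl⟩
  have hB : DPP.IsPartition fun i => κ ⁻¹' {i} :=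
    ⟨pairwise_disjoint_fiber κ, by rw [← Set.preimage_iUnion, Set.iUnion_of_singleton]; rfl⟩
  exact ⟨F, hF, inferInstance, inferInstance, inferInstance, inferInstance, fun i => κ ⁻¹' {i},
    b.repr.conjStarAlgEquiv K, hB, hK.conjStarAlgEquiv b.repr, ⟨b.repr, fun f => by simp⟩,
    hK.exists_isDiscreteDeterminantalLaw b, fun P P' hP hP' =>
      DPP.jointCountLaw_eq_of_adapted_hilbertBasis hK.1 hK' hA.1 hA_meas hA_compact hB.1 hb hP hP'⟩
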